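/- Let $\mathbb{F}_q$ be a finite field, let $d\ge 0$, and for $k\in\{1,2,3\}$ let $V_k\in\mathbb{F}_q^{d\times m_k}$ (demand of user $k$) and $V_k'\in\mathbb{F}_q^{d\times m_k'}$ (side-information of user $k$) be arbitrary matrices. A scheme consists of a batch size $L\ge 1$, a finite alphabet $\mathcal S$, an encoder $\Phi:\mathbb{F}_q^{d\times L}\to\mathcal S$ and decoders $\Psi_k:\mathcal S\times\mathbb{F}_q^{L\times m_k'}\to\mathbb{F}_q^{L\times m_k}$ (arbitrary maps, not necessarily linear) such that $\Psi_k(\Phi(X),X^TV_k')=X^TV_k$ for every $X\in\mathbb{F}_q^{d\times L}$ and every $k\in\{1,2,3\}$; its normalized broadcast cost is $\log_q|\mathcal S|/L$. The optimal broadcast cost $\Delta^*$ of this 3-user linear computation broadcast problem is the infimum of the normalized broadcast costs of all schemes, and its capacity is $C^*=1/\Delta^*$ (with $1/0=\infty$). Identify matrices with $d$ rows with their column spans, write $[A,B]$ for the concatenation of $A$ and $B$ (whose column span is the sum of the two column spans) and $A\cap B$ for the intersection of the column spans, and put $\mathrm{rk}(A\mid B)=\mathrm{rk}([A,B])-\mathrm{rk}(B)$.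 Let $U_k=[V_k',V_k]$, $U_{ij}=U_i\cap U_j$, $U_{123}=U_1\cap U_2\cap U_3$ and $U_{i(j,k)}=U_i\cap[U_j,U_k]$. For each permutation $(i,j,k)$ of $(1,2,3)$ let $$\Delta_1^{ijk}=\sum_{l=1}^3\mathrm{rk}(V_l\mid V_l')-\mathrm{rk}(U_{ij}\mid V_j')-\mathrm{rk}(U_{k(i,j)}\mid V_k'),$$ $$\Delta_2^{ijk}=\sum_{l=1}^3\mathrm{rk}(V_l\mid V_l')-\frac12\Big(\min_{\ell\in\{1,2,3\}}\mathrm{rk}(U_{123}\mid V_\ell')+\mathrm{rk}([U_{ij},U_{ik}]\mid V_i')+\mathrm{rk}(U_{j(i,k)}\mid V_j')+\mathrm{rk}(U_{k(i,j)}\mid V_k')\Big),$$ and let $\Delta_n=\max_{(i,j,k)}\Delta_n^{ijk}$ for $n\in\{1,2\}$, the maximum being over all permutations $(i,j,k)$ of $(1,2,3)$. Then $$\Delta^*=\max\{\Delta_1,\Delta_2\},\qquad\text{equivalently}\qquad C^*=\frac{1}{\max\{\Delta_1,\Delta_2\}}.$$ -/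

import Mathlib

open scoped ENNReal

noncomputable section

/-- Data of a `K`-user linear computation broadcast problem with `d`-dimensional data over `F`:
user `k` wants the projection of the data along `V k` and knows its projection along `V' k`. -/
structure LCBC (F : Type*) [Field F] (K d : ℕ) where
  /-- number of columns of the demand matrices -/
  m : Fin K → ℕ
  /-- number of columns of the side-information matrices -/
  m' : Fin K → ℕ
  /-- demands -/
  V : (k : Fin K) → Matrix (Fin d) (Fin (m k)) F
  /-- side-informations -/
  V' : (k : Fin K) → Matrix (Fin d) (Fin (m' k)) F

namespace LCBC

variable {F : Type*} [Field F] {K d : ℕ}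

/-- An achievable scheme: a batch size `L ≥ 1`, a finite broadcast alphabet `S`, an arbitrary (not
necessarily linear) encoder and arbitrary decoders, with zero-error decoding for every data
realization `X` and every user. -/
structure Scheme (P : LCBC F K d) where
  /-- batch size -/
  L : ℕ
  L_pos : 0 < L
  /-- broadcast alphabet -/
  S : Type
  [fintypeS : Fintype S]
  /-- encoder -/
  enc : Matrix (Fin d) (Fin L) F → S
  /-- decoders -/
  dec : (k : Fin K) → S → Matrix (Fin L) (Fin (P.m' k)) F → Matrix (Fin L) (Fin (P.m k)) F
  decodes : ∀ (X : Matrix (Fin d) (Fin L) F) (k : Fin K),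
    dec k (enc X) (X.transpose * P.V' k) = X.transpose * P.V k

attribute [instance] Scheme.fintypeS

/-- Normalized broadcast cost `log_q |S| / L` of a scheme, with `q = |F|`. -/
def Scheme.cost [Fintype F] {P : LCBC F K d} (s : P.Scheme) : ℝ :=
  Real.logb (Fintype.card F) (Fintype.card s.S) / s.L

/-- The set of normalized broadcast costs of all schemes. -/
def achievableCosts [Fintype F] (P : LCBC F K d) : Set ℝ :=
  Set.range fun s : P.Scheme => s.cost

/-- Optimal broadcast cost per computation: the infimum of `log_q |S| / L` over all schemes. -/
def optimalCost [Fintype F] (P : LCBC F K d) : ℝ :=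
  sInf P.achievableCosts

/-- Capacity: the reciprocal of the optimal broadcast cost (`∞` if that cost is `0`). -/
def capacity [Fintype F] (P : LCBC F K d) : ℝ≥0∞ :=
  1 / ENNReal.ofReal P.optimalCost

/-- Column span of a matrix. -/
def colSpan {n : Type*} (M : Matrix (Fin d) n F) : Submodule F (Fin d → F) :=
  Submodule.span F (Set.range M.col)

/-- Conditional rank `rk(A ∣ B) = rk([A, B]) - rk(B)` of (matrices with column spans) `A`, `B`. -/
def condRank (A B : Submodule F (Fin d → F)) : ℝ :=
  (Module.finrank F ↥(A ⊔ B) : ℝ) - (Module.finrank F ↥B : ℝ)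

/-- `⟨V k⟩`. -/
def demand (P : LCBC F K d) (k : Fin K) : Submodule F (Fin d → F) :=
  colSpan (P.V k)

/-- `⟨V' k⟩`. -/
def side (P : LCBC F K d) (k : Fin K) : Submodule F (Fin d → F) :=
  colSpan (P.V' k)

/-- The signal space `⟨U_k⟩` of user `k`, where `U_k = [V'_k, V_k]`. -/
def U (P : LCBC F K d) (k : Fin K) : Submodule F (Fin d → F) :=
  colSpan (Matrix.fromCols (P.V' k) (P.V k))

/-- `U_{ij} = U_i ∩ U_j`. -/
def Uinter (P : LCBC F K d) (i j : Fin K) : Submodule F (Fin d → F) :=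
  P.U i ⊓ P.U j

/-- `U_{i(j,k)} = U_i ∩ [U_j, U_k]`. -/
def UinterSum (P : LCBC F K d) (i j k : Fin K) : Submodule F (Fin d → F) :=
  P.U i ⊓ (P.U j ⊔ P.U k)

/-- `U_{123} = U_1 ∩ U_2 ∩ U_3`. -/
def U123 (P : LCBC F 3 d) : Submodule F (Fin d → F) :=
  P.U 0 ⊓ P.U 1 ⊓ P.U 2

/-- `rk(V_1 ∣ V'_1) + rk(V_2 ∣ V'_2) + rk(V_3 ∣ V'_3)`. -/
def demandRank (P : LCBC F 3 d) : ℝ :=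
  condRank (P.demand 0) (P.side 0) + condRank (P.demand 1) (P.side 1)
    + condRank (P.demand 2) (P.side 2)

/-- `Δ_1^{ijk}`. -/
def delta1 (P : LCBC F 3 d) (i j k : Fin 3) : ℝ :=
  P.demandRank - condRank (P.Uinter i j) (P.side j) - condRank (P.UinterSum k i j) (P.side k)

/-- `Δ_2^{ijk}`. -/
def delta2 (P : LCBC F 3 d) (i j k : Fin 3) : ℝ :=
  P.demandRank - (1 / 2) *
    (Finset.univ.inf' Finset.univ_nonempty (fun l : Fin 3 => condRank P.U123 (P.side l))
      + condRank (P.Uinter i j ⊔ P.Uinter i k) (P.side i)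
      + condRank (P.UinterSum j i k) (P.side j)
      + condRank (P.UinterSum k i j) (P.side k))

/-- `Δ_1`, the maximum of `Δ_1^{ijk}` over all permutations `(i, j, k)` of the three users. -/
def Delta1 (P : LCBC F 3 d) : ℝ :=
  Finset.univ.sup' Finset.univ_nonempty
    (fun σ : Equiv.Perm (Fin 3) => P.delta1 (σ 0) (σ 1) (σ 2))

/-- `Δ_2`, the maximum of `Δ_2^{ijk}` over all permutations `(i, j, k)` of the three users. -/
def Delta2 (P : LCBC F 3 d) : ℝ :=
  Finset.univ.sup' Finset.univ_nonempty
    (fun σ : Equiv.Perm (Fin 3) => P.delta2 (σ 0) (σ 1) (σ 2))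

end LCBC

end

/-! Converse. For a scheme and a subspace `T`, let g(T) be the normalized entropy of the broadcast
symbol given the projections of uniform data along `T` (`Scheme.remainder`). This g is nonnegative,
antitone and submodular, and g(0) is at most the cost. Decodability says that g + rank takes the
same value at T + V'_k and T + U_k, so adjoining U_k to T lowers g by at least rk(V_k | V'_k) - rk(T
∩ U_k | V'_k) (`broadcast_gain`). Chaining this along 0, U_i, U_i + U_j, U_1 + U_2 + U_3 gives the
first bound; three uses of submodularity give the second. Entropy is treated combinatorially,
through the class sizes of equivalence relations on the data.

Achievability. Two copies of the data are viewed over an extension field E, and a subspace B is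
broadcast that completes every V'_k to U_k; the cost is dim B / 2 (`exists_scheme_of_subspace`),
which accounts for the factor 1/2 in the second bound. B is spanned by generic vectors of four
types: from U_123, from a pairwise intersection, from a single U_k, and pairs (x, y) with x in U_1,
y in U_2, x + y in U_3, which cost two dimensions and give each of the three users one. A Hall-type
rank condition suffices for generic choices to serve all users at once (`exists_generic_subspaces`).
With explicit numbers of vectors of each type (`exists_symbol_counts`), the condition reduces to the
inequalities that define the two bounds, so the infimum is attained. -/

/-! ### Generic subspaces over a large finite field. -/

open scoped Pointwise in
/-- Finitely many proper subspaces, fewer than there are scalars, do not cover a vector space. -/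
theorem exists_notMem_of_card_lt {E M κ : Type*} [Field E] [Finite E] [AddCommGroup M] [Module E M]
    [Finite M] [Fintype κ] (p : κ → Submodule E M) (hp : ∀ k, p k ≠ ⊤)
    (hcard : Fintype.card κ < Nat.card E) : ∃ z, ∀ k, z ∉ p k := by
  classical
  by_contra! hcon
  have hcov : ⋃ k ∈ (Finset.univ : Finset κ), ((0 : M) +ᵥ ((p k).toAddSubgroup : Set M)) =
      Set.univ := by
    ext z
    obtain ⟨k, hk⟩ := hcon z
    simp only [zero_vadd, Set.mem_iUnion, Set.mem_univ, iff_true]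
    exact ⟨k, Finset.mem_univ _, hk⟩
  -- B. H. Neumann's lemma: in a finite cover by cosets, some subgroup has index at most the number
  -- of cosets. A proper subspace has index at least `|E|`, because the multiples of a vector
  -- outside it lie in distinct cosets.
  obtain ⟨k, -, -, hk⟩ := AddSubgroup.exists_index_le_card_of_leftCoset_cover hcov
  have : Nat.card E ≤ (p k).toAddSubgroup.index := by
    obtain ⟨x, hx⟩ := not_forall.mp fun h => hp k (eq_top_iff.mpr fun x _ => h x)
    rw [AddSubgroup.index]
    have : Function.Injective fun e : E => (QuotientAddGroup.mk (e • x) : M ⧸ (p k).toAddSubgroup) := by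
      intro e e' h
      by_contra hne
      apply hx
      have h1 : -(e • x) + e' • x ∈ p k := (QuotientAddGroup.eq).mp h
      have h2 : (e' - e) • x ∈ p k := by
        rw [sub_smul]; convert h1 using 1; abel
      exact ((p k).smul_mem_iff (sub_ne_zero.mpr (Ne.symm hne))).mp h2
    exact Nat.card_le_card_of_injective _ this
  simp only [Finset.card_univ] at hk
  omega

/-- Generic subspaces of prescribed dimensions in given spaces achieve every rank that is not
excluded by a dimension count, simultaneously for several observers. -/
theorem exists_generic_subspaces {E M V τ ι : Type*} [Field E] [Finite E] [AddCommGroup M]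
    [Module E M] [Finite M] [AddCommGroup V] [Module E V] [Finite V] [Fintype τ] [DecidableEq τ]
    [Fintype ι] (hcard : Fintype.card (ι × Finset τ) < Nat.card E)
    (Z : τ → Submodule E M) (f : τ → ι → M →ₗ[E] V) (u : ι → ℕ)
    (T : ι → Submodule E V) (n : τ → ℕ)
    (h : ∀ i (J : Finset τ), u i ≤
      Module.finrank E ↥(T i ⊔ ⨆ t ∈ J, (Z t).map (f t i)) + ∑ t ∈ Jᶜ, n t) :
    ∃ S : τ → Submodule E M, (∀ t, S t ≤ Z t) ∧ (∀ t, Module.finrank E (S t) ≤ n t) ∧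
      ∀ i, u i ≤ Module.finrank E ↥(T i ⊔ ⨆ t, (S t).map (f t i)) := by
  induction hN : ∑ t, n t generalizing T n with
  | zero =>
    refine ⟨fun _ => ⊥, fun _ => bot_le, fun t => by simp, fun i => ?_⟩
    have h0 : ∀ t, n t = 0 := by simpa using hN
    have h1 := h i ∅
    simp only [h0, Finset.sum_const_zero, add_zero] at h1
    refine h1.trans (Submodule.finrank_mono (sup_le_sup_left ?_ _))
    simp
  | succ N ih =>
    obtain ⟨t, -, ht⟩ : ∃ t ∈ Finset.univ, n t ≠ 0 :=
      Finset.exists_ne_zero_of_sum_ne_zero (by omega)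
    -- One vector of kind `t` is spent. It is chosen to be new, for every observer `i` and every
    -- `J`, wherever some vector of `Z t` would be new; each such pair `(i, J)` excludes one proper
    -- subspace of `Z t`.
    obtain ⟨z, hz⟩ : ∃ z : Z t, ∀ (i : ι) (J : Finset τ),
        ¬ (Z t).map (f t i) ≤ T i ⊔ ⨆ t ∈ J, (Z t).map (f t i) →
          f t i z ∉ T i ⊔ ⨆ t ∈ J, (Z t).map (f t i) := by
      let κ := {k : ι × Finset τ // ¬ (Z t).map (f t k.1) ≤ T k.1 ⊔ ⨆ t ∈ k.2, (Z t).map (f t k.1)}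
      have : Fintype κ := Fintype.ofFinite _
      obtain ⟨z, hz⟩ := exists_notMem_of_card_lt (E := E) (M := Z t) (κ := κ)
        (fun k => ((T k.1.1 ⊔ ⨆ t ∈ k.1.2, (Z t).map (f t k.1.1)).comap (f t k.1.1)).comap
          (Z t).subtype) (by
          rintro ⟨k, hk⟩ htop
          apply hk
          rintro _ ⟨y, hy, rfl⟩
          have : (⟨y, hy⟩ : Z t) ∈ (⊤ : Submodule E (Z t)) := trivial
          rw [← htop] at this
          exact this) (lt_of_le_of_lt (Fintype.card_subtype_le _) hcard)
      exact ⟨z, fun i J hJ => hz ⟨(i, J), hJ⟩⟩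
    obtain ⟨S, hSZ, hSn, hS⟩ := ih (fun i => T i ⊔ Submodule.span E {f t i z})
      (Function.update n t (n t - 1)) (by
        intro i J
        by_cases htJ : t ∈ J
        · have h1 : ∑ s ∈ Jᶜ, Function.update n t (n t - 1) s = ∑ s ∈ Jᶜ, n s :=
            Finset.sum_congr rfl fun s hs => Function.update_of_ne (by
              rintro rfl; exact (Finset.mem_compl.mp hs) htJ) _ _
          rw [h1]
          refine (h i J).trans (Nat.add_le_add_right (Submodule.finrank_mono ?_) _)
          exact sup_le_sup_right le_sup_left _
        · have hJc : Jᶜ = insert t (insert t J)ᶜ := by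
            ext s; by_cases hs : s = t <;> simp [hs, htJ]
          have hnot : t ∉ (insert t J)ᶜ := by simp
          have h1 : ∑ s ∈ Jᶜ, Function.update n t (n t - 1) s =
              (n t - 1) + ∑ s ∈ (insert t J)ᶜ, n s := by
            rw [hJc, Finset.sum_insert hnot, Function.update_self]
            congr 1
            exact Finset.sum_congr rfl fun s hs => Function.update_of_ne (by
              rintro rfl; exact hnot hs) _ _
          have h2 : ∑ s ∈ Jᶜ, n s = n t + ∑ s ∈ (insert t J)ᶜ, n s := by
            rw [hJc, Finset.sum_insert hnot]
          have hle : T i ⊔ ⨆ t ∈ J, (Z t).map (f t i) ≤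
              T i ⊔ Submodule.span E {f t i z} ⊔ ⨆ t ∈ J, (Z t).map (f t i) :=
            sup_le_sup_right le_sup_left _
          -- For `t ∉ J` the budget on the right has dropped by one. Either kind `t` is already
          -- absorbed, and the old condition for `insert t J` is enough, or `z` raises the rank by
          -- one and makes up for the loss.
          by_cases hmap : (Z t).map (f t i) ≤ T i ⊔ ⨆ t ∈ J, (Z t).map (f t i)
          · have h3 := h i (insert t J)
            have h4 : T i ⊔ ⨆ s ∈ insert t J, (Z s).map (f s i) ≤
                T i ⊔ Submodule.span E {f t i z} ⊔ ⨆ t ∈ J, (Z t).map (f t i) := by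
              refine sup_le (le_sup_left.trans hle) (iSup₂_le fun s hs => ?_)
              rcases Finset.mem_insert.mp hs with rfl | hs
              · exact hmap.trans hle
              · exact (le_iSup₂ (f := fun s (_ : s ∈ J) => (Z s).map (f s i)) s hs).trans
                  le_sup_right
            have := Submodule.finrank_mono h4
            omega
          · have h3 := h i J
            have h4 : T i ⊔ ⨆ t ∈ J, (Z t).map (f t i) <
                T i ⊔ Submodule.span E {f t i z} ⊔ ⨆ t ∈ J, (Z t).map (f t i) := by
              refine lt_of_le_of_ne hle fun heq => hz i J hmap ?_
              rw [heq]
              exact le_sup_left (a := T i ⊔ Submodule.span E {f t i ↑z})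
                (le_sup_right (a := T i) (Submodule.mem_span_singleton_self _))
            have := Submodule.finrank_lt_finrank_of_lt h4
            omega) (by
        have := Finset.sum_update_of_mem (Finset.mem_univ t) n (n t - 1)
        have h2 := Finset.add_sum_erase Finset.univ n (Finset.mem_univ t)
        rw [this]
        rw [Finset.erase_eq] at h2
        omega)
    refine ⟨Function.update S t (S t ⊔ Submodule.span E {(z : M)}), fun s => ?_, fun s => ?_,
      fun i => ?_⟩
    · by_cases hs : s = t
      · subst hs
        rw [Function.update_self]
        exact sup_le (hSZ s) ((Submodule.span_singleton_le_iff_mem _ _).mpr z.2)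
      · rw [Function.update_of_ne hs]; exact hSZ s
    · have := hSn s
      by_cases hs : s = t
      · subst hs
        rw [Function.update_self] at this ⊢
        have h1 := Submodule.finrank_add_le_finrank_add_finrank (S s) (Submodule.span E {(z : M)})
        have h2 : Module.finrank E (Submodule.span E {(z : M)}) ≤ 1 := by
          simpa using finrank_span_le_card (R := E) ({(z : M)} : Set M)
        omega
      · rwa [Function.update_of_ne hs] at this ⊢
    · refine (hS i).trans (Submodule.finrank_mono ?_)
      have hmono : ∀ s, S s ≤ Function.update S t (S t ⊔ Submodule.span E {(z : M)}) s := by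
        intro s
        by_cases hs : s = t
        · subst hs; rw [Function.update_self]; exact le_sup_left
        · rw [Function.update_of_ne hs]
      refine sup_le (sup_le le_sup_left ?_) ?_
      · refine le_trans ?_ (le_sup_right.trans' (le_iSup _ t))
        rw [Function.update_self, Submodule.map_sup, Submodule.map_span, Set.image_singleton]
        exact le_sup_right
      · exact (iSup_mono fun s => Submodule.map_mono (hmono s)).trans le_sup_right

theorem finrank_finset_sup_le_sum {E V τ : Type*} [Field E] [AddCommGroup V] [Module E V]
    [FiniteDimensional E V] (s : Finset τ) (p : τ → Submodule E V) :
    Module.finrank E ↥(s.sup p) ≤ ∑ t ∈ s, Module.finrank E (p t) := by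
  classical
  induction s using Finset.induction_on with
  | empty => simp
  | insert t s ht ih =>
    rw [Finset.sup_insert, Finset.sum_insert ht]
    exact (Submodule.finrank_add_le_finrank_add_finrank _ _).trans (Nat.add_le_add_left ih _)

/-! ### Broadcast symbols for three users. -/

section Broadcast

variable {E V : Type*} [Field E] [AddCommGroup V] [Module E V] (U : Fin 3 → Submodule E V)

/-- Kinds of broadcast symbols: `inl false` is useful to all users, `inl true` stands for a pair of
symbols that gives each user one dimension, `inr (inl k)` is useful to the two users other
than `k`, and `inr (inr k)` to user `k` only. -/
abbrev SymbolKind := Bool ⊕ (Fin 3 ⊕ Fin 3)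

/-- The pairs of vectors from which broadcast symbols of a given kind are chosen. -/
def symbolSpace : SymbolKind → Submodule E (V × V)
  | .inl false => (U 0 ⊓ U 1 ⊓ U 2).map (LinearMap.inl E V V)
  | .inl true => (U 0).comap (LinearMap.fst E V V) ⊓ (U 1).comap (LinearMap.snd E V V) ⊓
      (U 2).comap (LinearMap.fst E V V + LinearMap.snd E V V)
  | .inr (.inl k) => (U (k + 1) ⊓ U (k + 2)).map (LinearMap.inl E V V)
  | .inr (.inr k) => (U k).map (LinearMap.inl E V V)

/-- What user `i` makes of a broadcast pair of a given kind. -/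
def symbolMap : SymbolKind → Fin 3 → V × V →ₗ[E] V
  | .inl false, _ => LinearMap.fst E V V
  | .inl true, i => ![LinearMap.fst E V V, LinearMap.snd E V V,
      LinearMap.fst E V V + LinearMap.snd E V V] i
  | .inr (.inl k), i => if i = k then 0 else LinearMap.fst E V V
  | .inr (.inr k), i => if i = k then LinearMap.fst E V V else 0

/-- Numbers of broadcast symbols of each kind. -/
def symbolCount (l m : ℕ) (w s : Fin 3 → ℕ) : SymbolKind → ℕ
  | .inl false => l
  | .inl true => m
  | .inr (.inl k) => w k
  | .inr (.inr k) => s k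

theorem map_fst_map_inl (p : Submodule E V) :
    (p.map (LinearMap.inl E V V)).map (LinearMap.fst E V V) = p := by
  rw [← Submodule.map_comp, LinearMap.fst_comp_inl, Submodule.map_id]

theorem map_symbolMap_le (t : SymbolKind) (i : Fin 3) :
    (symbolSpace U t).map (symbolMap t i) ≤ U i := by
  rcases t with (_ | _) | k | k
  · simp only [symbolSpace, symbolMap, map_fst_map_inl]
    fin_cases i
    · exact inf_le_left.trans inf_le_left
    · exact inf_le_left.trans inf_le_right
    · exact inf_le_right
  · rw [Submodule.map_le_iff_le_comap]
    fin_cases i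
    · exact inf_le_left.trans inf_le_left
    · exact inf_le_left.trans inf_le_right
    · exact inf_le_right
  · simp only [symbolSpace, symbolMap]
    split_ifs with h
    · simp
    · rw [map_fst_map_inl]
      have : i = k + 1 ∨ i = k + 2 := by revert i k; decide
      rcases this with rfl | rfl
      · exact inf_le_left
      · exact inf_le_right
  · simp only [symbolSpace, symbolMap]
    split_ifs with h
    · rw [map_fst_map_inl, h]
    · simp

theorem map_symbolMap_le_sup (S : Submodule E (V × V)) (t : SymbolKind) (i : Fin 3) :
    S.map (symbolMap t i) ≤ S.map (LinearMap.fst E V V) ⊔ S.map (LinearMap.snd E V V) := by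
  have hf : ∀ x ∈ S, x.1 ∈ S.map (LinearMap.fst E V V) ⊔ S.map (LinearMap.snd E V V) :=
    fun x hx => Submodule.mem_sup_left ⟨x, hx, rfl⟩
  have hs : ∀ x ∈ S, x.2 ∈ S.map (LinearMap.fst E V V) ⊔ S.map (LinearMap.snd E V V) :=
    fun x hx => Submodule.mem_sup_right ⟨x, hx, rfl⟩
  rintro _ ⟨x, hx, rfl⟩
  rcases t with (_ | _) | k | k
  · exact hf x hx
  · fin_cases i
    · exact hf x hx
    · exact hs x hx
    · exact Submodule.add_mem _ (hf x hx) (hs x hx)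
  · simp only [symbolMap]
    split_ifs
    · exact Submodule.zero_mem _
    · exact hf x hx
  · simp only [symbolMap]
    split_ifs
    · exact hf x hx
    · exact Submodule.zero_mem _

theorem inf_le_map_symbolMap_pair (i k : Fin 3) (h : i ≠ k) :
    U (k + 1) ⊓ U (k + 2) ≤
      (symbolSpace U (.inr (.inl k))).map (symbolMap (.inr (.inl k)) i) := by
  simp only [symbolSpace, symbolMap, if_neg h, map_fst_map_inl]
  exact le_rfl

/-- A decomposition x = y + z over the other two signal spaces completes x, up to signs, to an
admissible pair in which user `i` sees x. Hence paired symbols reach everything that a user shares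
with the sum of the other two. -/
theorem inf_sup_le_map_symbolMap (i : Fin 3) :
    U i ⊓ (U (i + 1) ⊔ U (i + 2)) ≤
      (symbolSpace U (.inl true)).map (symbolMap (.inl true) i) := by
  rintro x ⟨hx, hyz⟩
  obtain ⟨y, hy, z, hz, rfl⟩ := Submodule.mem_sup.mp hyz
  fin_cases i
  · refine ⟨(y + z, -y), ⟨⟨hx, (U 1).neg_mem hy⟩, ?_⟩, rfl⟩
    change y + z + -y ∈ U 2
    rw [add_neg_cancel_comm]; exact hz
  · refine ⟨(-z, y + z), ⟨⟨(U 0).neg_mem hz, hx⟩, ?_⟩, rfl⟩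
    change -z + (y + z) ∈ U 2
    rw [neg_add_cancel_comm_assoc]; exact hy
  · exact ⟨(y, z), ⟨⟨hy, hz⟩, hx⟩, rfl⟩

/-- The six families of inequalities are what the Hall-type condition of `exists_generic_subspaces`
amounts to for one user, according to which kinds lie in `J`. `B` collects both components of all
chosen pairs; only the paired kind has a nonzero second component, hence the cost `2 * m`. The
constant is 768 = 3 · 2 ^ 8, for three users and sets of the eight kinds. -/
theorem exists_broadcast_subspace [Finite E] [Finite V] (hcard : 768 < Nat.card E)
    (A : Fin 3 → Submodule E V) (hAU : ∀ i, A i ≤ U i) (l m : ℕ) (w s : Fin 3 → ℕ)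
    (hnone : ∀ i, Module.finrank E (U i) ≤
      Module.finrank E (A i) + l + w (i + 1) + w (i + 2) + m + s i)
    (hall : ∀ i, Module.finrank E (U i) ≤
      Module.finrank E ↥(A i ⊔ U 0 ⊓ U 1 ⊓ U 2) + w (i + 1) + w (i + 2) + m + s i)
    (hnext : ∀ i, Module.finrank E (U i) ≤
      Module.finrank E ↥(A i ⊔ U i ⊓ U (i + 1)) + w (i + 1) + m + s i)
    (hprev : ∀ i, Module.finrank E (U i) ≤
      Module.finrank E ↥(A i ⊔ U i ⊓ U (i + 2)) + w (i + 2) + m + s i)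
    (hpair : ∀ i, Module.finrank E (U i) ≤
      Module.finrank E ↥(A i ⊔ (U i ⊓ U (i + 1) ⊔ U i ⊓ U (i + 2))) + m + s i)
    (hsum : ∀ i, Module.finrank E (U i) ≤
      Module.finrank E ↥(A i ⊔ U i ⊓ (U (i + 1) ⊔ U (i + 2))) + s i) :
    ∃ B : Submodule E V, (∀ i, U i ≤ A i ⊔ B) ∧
      Module.finrank E B ≤ l + ∑ k, w k + 2 * m + ∑ k, s k := by
  obtain ⟨S, hSZ, hSn, hS⟩ := exists_generic_subspaces (E := E) (M := V × V) (V := V)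
    (τ := SymbolKind) (ι := Fin 3) (by
      rw [Fintype.card_prod, Fintype.card_finset]
      simpa using hcard)
    (symbolSpace U) symbolMap (fun i => Module.finrank E (U i)) A (symbolCount l m w s) (by
      intro i J
      set X := A i ⊔ ⨆ t ∈ J, (symbolSpace U t).map (symbolMap t i) with hX
      have hAX : A i ≤ X := le_sup_left
      have hJX : ∀ t ∈ J, (symbolSpace U t).map (symbolMap t i) ≤ X := fun t ht =>
        (le_iSup₂ (f := fun s (_ : s ∈ J) => (symbolSpace U s).map (symbolMap s i)) t ht).trans
          le_sup_right
      have hrank : ∀ p : Submodule E V, p ≤ X →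
          Module.finrank E p ≤ Module.finrank E X := fun p hp => Submodule.finrank_mono hp
      have hsumJ : ∑ t ∈ Jᶜ, symbolCount l m w s t =
          ∑ t, if t ∈ J then 0 else symbolCount l m w s t := by
        rw [Finset.sum_ite, Finset.sum_const_zero, zero_add]
        congr 1; ext; simp
      have hperm : ∀ g : Fin 3 → ℕ, ∑ k, g k = g i + g (i + 1) + g (i + 2) := by
        intro g
        rw [Fin.sum_univ_three]
        fin_cases i
        · rfl
        · change _ = g 1 + g 2 + g 0; omega
        · change _ = g 2 + g 0 + g 1; omega
      rw [hsumJ, Fintype.sum_sum_type, Fintype.sum_sum_type, Fintype.sum_bool, hperm, hperm]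
      simp only [symbolCount]
      have e1 := (by decide : ∀ i : Fin 3, i + 1 + 1 = i + 2) i
      have e2 := (by decide : ∀ i : Fin 3, i + 1 + 2 = i) i
      have e3 := (by decide : ∀ i : Fin 3, i + 2 + 1 = i) i
      have e4 := (by decide : ∀ i : Fin 3, i + 2 + 2 = i + 1) i
      have n1 := (by decide : ∀ i : Fin 3, i ≠ i + 1) i
      have n2 := (by decide : ∀ i : Fin 3, i ≠ i + 2) i
      have c1 : Sum.inl false ∈ J → U 0 ⊓ U 1 ⊓ U 2 ≤ X := fun h => by
        have := hJX _ h
        simpa only [symbolSpace, symbolMap, map_fst_map_inl] using this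
      have c2 : Sum.inl true ∈ J → U i ⊓ (U (i + 1) ⊔ U (i + 2)) ≤ X := fun h =>
        (inf_sup_le_map_symbolMap U i).trans (hJX _ h)
      have c3 : Sum.inr (Sum.inl (i + 1)) ∈ J → U i ⊓ U (i + 2) ≤ X := fun h => by
        have := (inf_le_map_symbolMap_pair U i (i + 1) n1).trans (hJX _ h)
        rwa [e1, e2, inf_comm] at this
      have c4 : Sum.inr (Sum.inl (i + 2)) ∈ J → U i ⊓ U (i + 1) ≤ X := fun h => by
        have := (inf_le_map_symbolMap_pair U i (i + 2) n2).trans (hJX _ h)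
        rwa [e3, e4] at this
      have c5 : Sum.inr (Sum.inr i) ∈ J → U i ≤ X := fun h => by
        have := hJX _ h
        simpa only [symbolSpace, symbolMap, if_true, map_fst_map_inl] using this
      -- The kinds are tested from the largest space they offer user `i` to the smallest. Once one
      -- lies in `J`, the spaces below it add nothing to the bound and the counts below it are mere
      -- slack.
      by_cases h5 : Sum.inr (Sum.inr i) ∈ J
      · have := hrank _ (c5 h5); omega
      rw [if_neg h5]
      by_cases h2 : Sum.inl true ∈ J
      · have := hrank _ (sup_le hAX (c2 h2)); have := hsum i; omega
      rw [if_neg h2]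
      by_cases h3 : Sum.inr (Sum.inl (i + 1)) ∈ J <;> by_cases h4 : Sum.inr (Sum.inl (i + 2)) ∈ J
      · have := hrank _ (sup_le hAX (sup_le (c4 h4) (c3 h3))); have := hpair i; omega
      · rw [if_neg h4]
        have := hrank _ (sup_le hAX (c3 h3)); have := hprev i; omega
      · rw [if_neg h3]
        have := hrank _ (sup_le hAX (c4 h4)); have := hnext i; omega
      · rw [if_neg h3, if_neg h4]
        by_cases h1 : Sum.inl false ∈ J
        · have := hrank _ (sup_le hAX (c1 h1)); have := hall i; omega
        · rw [if_neg h1]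
          have := hrank _ hAX; have := hnone i; omega)
  refine ⟨Finset.univ.sup fun t => (S t).map (LinearMap.fst E V V) ⊔
    (S t).map (LinearMap.snd E V V), fun i => ?_, ?_⟩
  · have hle : A i ⊔ ⨆ t, (S t).map (symbolMap t i) ≤ U i :=
      sup_le (hAU i) (iSup_le fun t => (Submodule.map_mono (hSZ t)).trans
        (map_symbolMap_le U t i))
    rw [← Submodule.eq_of_le_of_finrank_le hle (hS i)]
    refine sup_le_sup_left (iSup_le fun t => (map_symbolMap_le_sup (S t) t i).trans ?_) _
    exact Finset.le_sup (f := fun t => (S t).map (LinearMap.fst E V V) ⊔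
      (S t).map (LinearMap.snd E V V)) (Finset.mem_univ t)
  · have hfst : ∀ t, Module.finrank E ((S t).map (LinearMap.fst E V V)) ≤
        symbolCount l m w s t := fun t => (Submodule.finrank_map_le _ _).trans (hSn t)
    have hsnd : ∀ t, Module.finrank E ((S t).map (LinearMap.snd E V V)) ≤
        symbolCount l m w s t := fun t => (Submodule.finrank_map_le _ _).trans (hSn t)
    have hsnd0 : ∀ t, t ≠ .inl true → (S t).map (LinearMap.snd E V V) = ⊥ := by
      intro t ht
      have key : ∀ p : Submodule E V, S t ≤ p.map (LinearMap.inl E V V) →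
          (S t).map (LinearMap.snd E V V) = ⊥ := by
        intro p hp
        rw [eq_bot_iff]
        rintro _ ⟨x, hx, rfl⟩
        obtain ⟨y, -, rfl⟩ := hp hx
        exact Submodule.zero_mem _
      have hZ := hSZ t
      rcases t with (_ | _) | k | k
      · exact key _ hZ
      · exact absurd rfl ht
      · exact key _ hZ
      · exact key _ hZ
    refine (finrank_finset_sup_le_sum _ _).trans ?_
    have hone : ∀ t, t ≠ .inl true → Module.finrank E ↥((S t).map (LinearMap.fst E V V) ⊔
        (S t).map (LinearMap.snd E V V)) ≤ symbolCount l m w s t := by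
      intro t ht
      rw [hsnd0 t ht, sup_bot_eq]
      exact hfst t
    have htwo := (Submodule.finrank_add_le_finrank_add_finrank
      ((S (.inl true)).map (LinearMap.fst E V V)) ((S (.inl true)).map (LinearMap.snd E V V))).trans
      (Nat.add_le_add (hfst _) (hsnd _))
    rw [Fintype.sum_sum_type, Fintype.sum_sum_type, Fintype.sum_bool]
    have h1 := hone (.inl false) (by simp)
    have h2 := Finset.sum_le_sum fun k (_ : k ∈ Finset.univ) => hone (.inr (.inl k)) (by simp)
    have h3 := Finset.sum_le_sum fun k (_ : k ∈ Finset.univ) => hone (.inr (.inr k)) (by simp)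
    simp only [symbolCount] at h1 h2 h3 htwo
    omega

end Broadcast

/-! ### Doubling and extension of scalars. -/

section Doubling

open TensorProduct

variable {F E W : Type*} [Field F] [Field E] [Algebra F E] [AddCommGroup W] [Module F W]

variable (E) in
/-- The extension of scalars of `p × p`. -/
def doubledBaseChange (p : Submodule F W) : Submodule E (E ⊗[F] (W × W)) :=
  (p.prod p).baseChange E

theorem finrank_submodule_prod [FiniteDimensional F W] (p q : Submodule F W) :
    Module.finrank F ↥(p.prod q) = Module.finrank F p + Module.finrank F q := by
  rw [← Module.finrank_prod]
  refine LinearEquiv.finrank_eq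
    { toFun := fun x => (⟨x.1.1, x.2.1⟩, ⟨x.1.2, x.2.2⟩)
      invFun := fun x => ⟨(x.1, x.2), x.1.2, x.2.2⟩
      map_add' := fun _ _ => rfl
      map_smul' := fun _ _ => rfl
      left_inv := fun _ => rfl
      right_inv := fun _ => rfl }

theorem finrank_doubledBaseChange [FiniteDimensional F W] (p : Submodule F W) :
    Module.finrank E (doubledBaseChange E p) = 2 * Module.finrank F p := by
  rw [doubledBaseChange, ← (Submodule.toBaseChange.toLinearEquiv E (p.prod p)).finrank_eq,
    Module.finrank_baseChange, finrank_submodule_prod]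
  omega

theorem doubledBaseChange_mono {p q : Submodule F W} (h : p ≤ q) :
    doubledBaseChange E p ≤ doubledBaseChange E q :=
  Submodule.baseChange_mono E (Submodule.prod_mono h h)

theorem doubledBaseChange_le_iff {p : Submodule F W} {q : Submodule E (E ⊗[F] (W × W))} :
    doubledBaseChange E p ≤ q ↔ ∀ x ∈ p, ∀ y ∈ p, (1 : E) ⊗ₜ[F] (x, y) ∈ q := by
  rw [doubledBaseChange, Submodule.baseChange_eq_span, Submodule.span_le]
  constructor
  · intro h x hx y hy
    exact h ⟨(x, y), ⟨hx, hy⟩, rfl⟩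
  · rintro h _ ⟨⟨x, y⟩, ⟨hx, hy⟩, rfl⟩
    exact h x hx y hy

theorem doubledBaseChange_sup (p q : Submodule F W) :
    doubledBaseChange E (p ⊔ q) = doubledBaseChange E p ⊔ doubledBaseChange E q := by
  refine le_antisymm (doubledBaseChange_le_iff.mpr ?_)
    (sup_le (doubledBaseChange_mono le_sup_left) (doubledBaseChange_mono le_sup_right))
  intro x hx y hy
  obtain ⟨x₁, hx₁, x₂, hx₂, rfl⟩ := Submodule.mem_sup.mp hx
  obtain ⟨y₁, hy₁, y₂, hy₂, rfl⟩ := Submodule.mem_sup.mp hy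
  rw [← Prod.mk_add_mk, TensorProduct.tmul_add]
  exact Submodule.add_mem_sup (doubledBaseChange_le_iff.mp le_rfl _ hx₁ _ hy₁)
    (doubledBaseChange_le_iff.mp le_rfl _ hx₂ _ hy₂)

/-- One inclusion is monotonicity; the dimensions agree by the modular rank formula, since sums are
preserved and all ranks double. -/
theorem doubledBaseChange_inf [FiniteDimensional F W] (p q : Submodule F W) :
    doubledBaseChange E (p ⊓ q) = doubledBaseChange E p ⊓ doubledBaseChange E q := by
  refine Submodule.eq_of_le_of_finrank_le
    (le_inf (doubledBaseChange_mono inf_le_left) (doubledBaseChange_mono inf_le_right)) ?_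
  have h1 := Submodule.finrank_sup_add_finrank_inf_eq p q
  have h2 := Submodule.finrank_sup_add_finrank_inf_eq (doubledBaseChange E p)
    (doubledBaseChange E q)
  rw [← doubledBaseChange_sup] at h2
  simp only [finrank_doubledBaseChange] at h2 ⊢
  omega

end Doubling

/-! ### From subspaces to schemes. -/

namespace LCBC

open TensorProduct

variable {F : Type*} [Field F] {K d : ℕ} (P : LCBC F K d)

theorem U_eq (k : Fin K) : P.U k = P.side k ⊔ P.demand k := by
  rw [U, side, demand, colSpan, colSpan, colSpan, ← Submodule.span_union]
  congr 1
  ext v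
  constructor
  · rintro ⟨j | j, rfl⟩
    · exact Or.inl ⟨j, rfl⟩
    · exact Or.inr ⟨j, rfl⟩
  · rintro (⟨j, rfl⟩ | ⟨j, rfl⟩)
    · exact ⟨Sum.inl j, rfl⟩
    · exact ⟨Sum.inr j, rfl⟩

theorem side_le_U (k : Fin K) : P.side k ≤ P.U k := P.U_eq k ▸ le_sup_left

theorem demand_le_U (k : Fin K) : P.demand k ≤ P.U k := P.U_eq k ▸ le_sup_right

/-- Two data matrices have the same products with `M` iff they agree on the column span of `M`. -/
theorem transpose_mul_eq_iff {L m : ℕ} (X Y : Matrix (Fin d) (Fin L) F)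
    (M : Matrix (Fin d) (Fin m) F) :
    X.transpose * M = Y.transpose * M ↔
      ∀ v ∈ colSpan M, X.transpose.mulVec v = Y.transpose.mulVec v := by
  constructor
  · intro h v hv
    have hle : colSpan M ≤ LinearMap.eqLocus X.transpose.mulVecLin Y.transpose.mulVecLin := by
      rw [colSpan, Submodule.span_le]
      rintro _ ⟨j, rfl⟩
      funext i
      exact congrFun (congrFun h i) j
    exact hle hv
  · intro h
    ext i j
    exact congrFun (h (M.col j) (Submodule.subset_span ⟨j, rfl⟩)) i

/-- An encoder that lets every user tell apart data with different demands yields a scheme. -/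
theorem exists_scheme_of_encoder {S : Type*} [Finite S] {L : ℕ} (hL : 0 < L)
    (enc : Matrix (Fin d) (Fin L) F → S)
    (h : ∀ k X Y, enc X = enc Y → X.transpose * P.V' k = Y.transpose * P.V' k →
      X.transpose * P.V k = Y.transpose * P.V k) :
    ∃ s : P.Scheme, s.L = L ∧ Fintype.card s.S = Nat.card S := by
  classical
  -- The alphabet moves to `Fin` because a scheme's alphabet lives in `Type`. The decoder uses any
  -- data consistent with what it receives; the default `0` is never used on the output of the
  -- encoder.
  refine ⟨{ L := L, L_pos := hL, S := Fin (Nat.card S),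
            enc := fun X => Finite.equivFin S (enc X)
            dec := fun k c Z =>
              if hX : ∃ X : Matrix (Fin d) (Fin L) F,
                  Finite.equivFin S (enc X) = c ∧ X.transpose * P.V' k = Z
              then hX.choose.transpose * P.V k else 0
            decodes := fun X k => ?_ }, rfl, Fintype.card_fin _⟩
  have hX : ∃ Y : Matrix (Fin d) (Fin L) F, Finite.equivFin S (enc Y) =
      Finite.equivFin S (enc X) ∧ Y.transpose * P.V' k = X.transpose * P.V' k := ⟨X, rfl, rfl⟩
  rw [dif_pos hX]
  exact h k _ _ ((Finite.equivFin S).injective hX.choose_spec.1) hX.choose_spec.2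

/-- Broadcasting the evaluations of the data on a subspace `B` over an extension field is a scheme
if `B` and the side-information span the signal space of every user. -/
theorem exists_scheme_of_subspace [Fintype F] {E : Type*} [Field E] [Finite E] [Algebra F E]
    (B : Submodule E (E ⊗[F] ((Fin d → F) × (Fin d → F))))
    (hB : ∀ k, doubledBaseChange E (P.U k) ≤ doubledBaseChange E (P.side k) ⊔ B) :
    ∃ s : P.Scheme, s.cost = (Module.finrank E B : ℝ) / 2 := by
  have : Module.Finite F E := Module.Finite.of_finite
  have hn : 0 < Module.finrank F E := Module.finrank_pos
  set n := Module.finrank F E with hn_def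
  let b : Module.Basis (Fin n) F E := Module.finBasis F E
  let half₁ : (Fin (n + n) → F) →ₗ[F] E :=
    b.equivFun.symm.toLinearMap ∘ₗ LinearMap.funLeft F F (Fin.castAdd n)
  let half₂ : (Fin (n + n) → F) →ₗ[F] E :=
    b.equivFun.symm.toLinearMap ∘ₗ LinearMap.funLeft F F (Fin.natAdd n)
  -- A batch of `2 * n` samples is read as two elements of `E`, so the data become an `E`-linear
  -- functional on the doubled space; the broadcast is its restriction to `B`.
  let eval : Matrix (Fin d) (Fin (n + n)) F → (E ⊗[F] ((Fin d → F) × (Fin d → F)) →ₗ[E] E) :=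
    fun X => LinearMap.liftBaseChange E
      ((half₁ ∘ₗ X.transpose.mulVecLin).coprod (half₂ ∘ₗ X.transpose.mulVecLin))
  have heval : ∀ X v w, eval X (1 ⊗ₜ (v, w)) =
      half₁ (X.transpose.mulVec v) + half₂ (X.transpose.mulVec w) := fun X v w => by
    simp [eval, Matrix.mulVec_transpose]
  have hagree : ∀ X Y (p : Submodule F (Fin d → F)),
      (∀ v ∈ p, X.transpose.mulVec v = Y.transpose.mulVec v) ↔
        doubledBaseChange E p ≤ LinearMap.eqLocus (eval X) (eval Y) := by
    intro X Y p
    rw [doubledBaseChange_le_iff]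
    constructor
    · intro h v hv w hw
      rw [LinearMap.mem_eqLocus, heval, heval, h v hv, h w hw]
    · intro h v hv
      have h1 := h v hv 0 p.zero_mem
      have h2 := h 0 p.zero_mem v hv
      rw [LinearMap.mem_eqLocus, heval, heval] at h1 h2
      simp only [Matrix.mulVec_zero, map_zero, add_zero, zero_add] at h1 h2
      have h1' := b.equivFun.symm.injective h1
      have h2' := b.equivFun.symm.injective h2
      funext i
      refine Fin.addCases (fun j => congrFun h1' j) (fun j => congrFun h2' j) i
  have : Module.Finite E (E ⊗[F] ((Fin d → F) × (Fin d → F))) := inferInstance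
  have : Finite (B →ₗ[E] E) := Module.finite_of_finite E
  obtain ⟨s, hsL, hsS⟩ := P.exists_scheme_of_encoder (S := B →ₗ[E] E) (L := n + n) (by omega)
    (fun X => (eval X).domRestrict B) (by
      intro k X Y hXY hside
      rw [transpose_mul_eq_iff] at hside ⊢
      have h1 := (hagree X Y _).mp hside
      have h2 : B ≤ LinearMap.eqLocus (eval X) (eval Y) := fun x hx =>
        LinearMap.congr_fun hXY ⟨x, hx⟩
      have h3 := (hagree X Y _).mpr ((hB k).trans (sup_le h1 h2))
      exact fun v hv => h3 v (P.demand_le_U k hv))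
  refine ⟨s, ?_⟩
  -- The broadcast takes `n * dim B` symbols of `F` for a batch of length `2 * n`, whence the cost
  -- `dim B / 2`.
  have hcard : Nat.card (B →ₗ[E] E) = Fintype.card F ^ (n * Module.finrank E B) := by
    rw [Module.natCard_eq_pow_finrank (K := E), Subspace.dual_finrank_eq (K := E) (V := B),
      Module.natCard_eq_pow_finrank (K := F) (V := E), Nat.card_eq_fintype_card, ← hn_def,
      ← pow_mul]
  have hq : (1 : ℝ) < Fintype.card F := by exact_mod_cast Fintype.one_lt_card
  rw [Scheme.cost, hsL, hsS, hcard, Nat.cast_pow, Real.logb_pow, Real.logb_self_eq_one hq]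
  have : (n : ℝ) ≠ 0 := by exact_mod_cast hn.ne'
  push_cast
  field_simp
  norm_num

end LCBC

/-! ### Symbol counts and achievability. -/

/-- The numbers of broadcast symbols of each kind (in a doubled scheme) that serve all users while
sending `t` symbols fewer than the separate demands `2 * r i` take. -/
theorem exists_symbol_counts (t a : ℤ) (g bn bp c e r : Fin 3 → ℤ) (ha : 0 ≤ a)
    (hag : ∀ i, a ≤ g i) (hgn : ∀ i, g i ≤ bn i) (hgp : ∀ i, g i ≤ bp i)
    (hbc : ∀ i, bn i ≤ c i) (hbc' : ∀ i, bp i ≤ c i) (hce : ∀ i, c i ≤ e i)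
    (her : ∀ i, e i ≤ r i) (hat : 4 * a ≤ t)
    (htn : ∀ i, t ≤ 2 * (bn i + e (i + 2))) (htp : ∀ i, t ≤ 2 * (bp i + e (i + 1)))
    (htc : ∀ i, t ≤ a + c i + e (i + 1) + e (i + 2)) :
    ∃ (l m : ℕ) (w s : Fin 3 → ℕ),
      (∀ i, 2 * r i ≤ l + w (i + 1) + w (i + 2) + m + s i) ∧
      (∀ i, 2 * r i ≤ 2 * g i + w (i + 1) + w (i + 2) + m + s i) ∧
      (∀ i, 2 * r i ≤ 2 * bn i + w (i + 1) + m + s i) ∧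
      (∀ i, 2 * r i ≤ 2 * bp i + w (i + 2) + m + s i) ∧
      (∀ i, 2 * r i ≤ 2 * c i + m + s i) ∧
      (∀ i, 2 * r i ≤ 2 * e i + s i) ∧
      ((l + ∑ k, w k + 2 * m + ∑ k, s k : ℕ) : ℤ) ≤ 2 * ∑ i, r i - t := by
  -- `w k` is the least number for which the condition involving `e k` holds, given the value of `s
  -- k` chosen below.
  have hw0 : ∀ k, 0 ≤ max 0 (t - 2 * a - 2 * e k) := fun k => le_max_left _ _
  obtain ⟨w, hw⟩ : ∃ w : Fin 3 → ℕ, ∀ k, (w k : ℤ) = max 0 (t - 2 * a - 2 * e k) :=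
    ⟨fun k => (max 0 (t - 2 * a - 2 * e k)).toNat, fun k => Int.toNat_of_nonneg (hw0 k)⟩
  simp only [Fin.forall_fin_succ, Fin.forall_fin_zero, Fin.isValue, Fin.sum_univ_three] at *
  simp only [Fin.isValue, Fin.succ_zero_eq_one, Fin.succ_one_eq_two, zero_add,
    Fin.reduceAdd, and_true] at *
  obtain ⟨hw1, hw2, hw3⟩ := hw
  -- According to how many `w k` are positive: none needs `hat`, one needs `a ≤ e k`, two need `htn`
  -- with `bn ≤ e`, three need `htc` with `c ≤ e`.
  have hm : 0 ≤ t - 4 * a - w 0 - w 1 - w 2 := by omega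
  -- With `l = 2 * a`, these `m` and `s` make the first family and the total cost equalities. The
  -- middle families then become `htn`, `htp`, `htc` and the comparisons with `a`.
  refine ⟨a.toNat + a.toNat, (t - 4 * a - w 0 - w 1 - w 2).toNat, w,
    fun k => (2 * r k - (t - 2 * a - w k)).toNat, ?_⟩
  have h0 : 0 ≤ 2 * r 0 - (t - 2 * a - w 0) := by omega
  have h1 : 0 ≤ 2 * r 1 - (t - 2 * a - w 1) := by omega
  have h2 : 0 ≤ 2 * r 2 - (t - 2 * a - w 2) := by omega
  push_cast
  rw [Int.toNat_of_nonneg hm, Int.toNat_of_nonneg h0, Int.toNat_of_nonneg h1,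
    Int.toNat_of_nonneg h2, Int.toNat_of_nonneg ha]
  refine ⟨⟨?_, ?_, ?_⟩, ⟨?_, ?_, ?_⟩, ⟨?_, ?_, ?_⟩, ⟨?_, ?_, ?_⟩, ⟨?_, ?_, ?_⟩, ⟨?_, ?_, ?_⟩, ?_⟩ <;>
    omega

namespace LCBC

variable {F : Type*} [Field F] {d : ℕ}

/-- `condRank` as an integer. -/
noncomputable def intCondRank (A B : Submodule F (Fin d → F)) : ℤ :=
  (Module.finrank F ↥(A ⊔ B) : ℤ) - (Module.finrank F ↥B : ℤ)

theorem condRank_eq_intCondRank (A B : Submodule F (Fin d → F)) :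
    condRank A B = (intCondRank A B : ℝ) := by
  simp [condRank, intCondRank]

theorem intCondRank_mono {A A' : Submodule F (Fin d → F)} (B : Submodule F (Fin d → F))
    (h : A ≤ A') : intCondRank A B ≤ intCondRank A' B := by
  have := Submodule.finrank_mono (sup_le_sup_right h B)
  simp only [intCondRank]
  omega

theorem intCondRank_nonneg (A B : Submodule F (Fin d → F)) : 0 ≤ intCondRank A B := by
  have := Submodule.finrank_mono (le_sup_right : B ≤ A ⊔ B)
  simp only [intCondRank]
  omega

variable (P : LCBC F 3 d)

theorem intCondRank_U (k : Fin 3) :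
    intCondRank (P.U k) (P.side k) = intCondRank (P.demand k) (P.side k) := by
  rw [intCondRank, intCondRank, sup_eq_left.mpr (P.side_le_U k), U_eq, sup_comm]

theorem finrank_U (k : Fin 3) : (Module.finrank F (P.U k) : ℤ) =
    Module.finrank F (P.side k) + intCondRank (P.demand k) (P.side k) := by
  rw [intCondRank, U_eq, sup_comm]
  ring

theorem U123_le (k : Fin 3) : P.U123 ≤ P.U k := by
  fin_cases k
  · exact inf_le_left.trans inf_le_left
  · exact inf_le_left.trans inf_le_right
  · exact inf_le_right

theorem finrank_doubled_sup {E : Type*} [Field E] [Algebra F E]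
    (A B : Submodule F (Fin d → F)) :
    (Module.finrank E ↥(doubledBaseChange E B ⊔ doubledBaseChange E A) : ℤ) =
      2 * (Module.finrank F B + intCondRank A B) := by
  rw [← doubledBaseChange_sup, finrank_doubledBaseChange, intCondRank, sup_comm]
  push_cast
  ring

/-- Here `t` is twice the saving over serving each demand separately, an integer because the scheme
is doubled. The hypotheses `h₁` and `h₂` say that the saving exceeds none of those in `delta1` and,
when `a` is the minimum there, `delta2`. -/
theorem exists_scheme_cost_le [Fintype F] (a t : ℤ) (ha : 0 ≤ a) (hat : 4 * a ≤ t)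
    (hag : ∀ i, a ≤ intCondRank P.U123 (P.side i))
    (h₁ : ∀ i j k, i ≠ j → i ≠ k → j ≠ k →
      t ≤ 2 * (intCondRank (P.Uinter i j) (P.side j) +
        intCondRank (P.UinterSum k i j) (P.side k)))
    (h₂ : ∀ i j k, i ≠ j → i ≠ k → j ≠ k →
      t ≤ a + intCondRank (P.Uinter i j ⊔ P.Uinter i k) (P.side i) +
        intCondRank (P.UinterSum j i k) (P.side j) +
        intCondRank (P.UinterSum k i j) (P.side k)) :
    ∃ s : P.Scheme, s.cost ≤ P.demandRank - t / 2 := by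
  have n₁ : ∀ i : Fin 3, i ≠ i + 1 := by decide
  have n₂ : ∀ i : Fin 3, i ≠ i + 2 := by decide
  have n₃ : ∀ i : Fin 3, i + 1 ≠ i + 2 := by decide
  have e₁ : ∀ i : Fin 3, i + 1 + 1 = i + 2 := by decide
  have e₂ : ∀ i : Fin 3, i + 1 + 2 = i := by decide
  have e₃ : ∀ i : Fin 3, i + 2 + 1 = i := by decide
  have e₄ : ∀ i : Fin 3, i + 2 + 2 = i + 1 := by decide
  let e : Fin 3 → ℤ := fun i => intCondRank (P.UinterSum i (i + 1) (i + 2)) (P.side i)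
  let bn : Fin 3 → ℤ := fun i => intCondRank (P.Uinter i (i + 1)) (P.side i)
  let bp : Fin 3 → ℤ := fun i => intCondRank (P.Uinter i (i + 2)) (P.side i)
  let c : Fin 3 → ℤ := fun i =>
    intCondRank (P.Uinter i (i + 1) ⊔ P.Uinter i (i + 2)) (P.side i)
  have hcomm : ∀ i j, P.Uinter i j = P.Uinter j i := fun i j => inf_comm _ _
  have hcomm' : ∀ i j k, P.UinterSum i j k = P.UinterSum i k j := fun i j k => by
    rw [UinterSum, UinterSum, sup_comm]
  have he1 : ∀ i, e (i + 1) = intCondRank (P.UinterSum (i + 1) i (i + 2)) (P.side (i + 1)) :=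
    fun i => by simp only [e]; rw [e₁, e₂, hcomm']
  have he2 : ∀ i, e (i + 2) = intCondRank (P.UinterSum (i + 2) i (i + 1)) (P.side (i + 2)) :=
    fun i => by simp only [e]; rw [e₃, e₄]
  obtain ⟨l, m, w, s, k₁, k₂, k₃, k₄, k₅, k₆, hcost⟩ := exists_symbol_counts t a
    (fun i => intCondRank P.U123 (P.side i)) bn bp c e
    (fun i => intCondRank (P.demand i) (P.side i)) ha hag
    (fun i => intCondRank_mono _ (le_inf (P.U123_le _) (P.U123_le _)))
    (fun i => intCondRank_mono _ (le_inf (P.U123_le _) (P.U123_le _)))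
    (fun i => intCondRank_mono _ le_sup_left)
    (fun i => intCondRank_mono _ le_sup_right)
    (fun i => intCondRank_mono _ (sup_le (inf_le_inf_left _ le_sup_left)
      (inf_le_inf_left _ le_sup_right)))
    (fun i => (intCondRank_mono _ inf_le_left).trans_eq (P.intCondRank_U i)) hat
    (fun i => by
      rw [he2]
      have := h₁ (i + 1) i (i + 2) (n₁ i).symm (n₃ i) (n₂ i)
      rwa [hcomm, hcomm'] at this)
    (fun i => by
      rw [he1]
      have := h₁ (i + 2) i (i + 1) (n₂ i).symm (n₃ i).symm (n₁ i)
      rwa [hcomm, hcomm'] at this)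
    (fun i => by
      rw [he1, he2]
      exact h₂ i (i + 1) (i + 2) (n₁ i) (n₂ i) (n₃ i))
  obtain ⟨p, hp⟩ := CharP.exists F
  have : Fact p.Prime := ⟨CharP.char_is_prime F p⟩
  -- Degree 10 is enough for every `F`, since 2 ^ 10 > 768.
  let E := FiniteField.Extension F p 10
  have hcard : 768 < Nat.card E := by
    rw [FiniteField.natCard_extension]
    have h2 : 2 ≤ Nat.card F := Finite.one_lt_card
    calc 768 < 2 ^ 10 := by norm_num
      _ ≤ Nat.card F ^ 10 := Nat.pow_le_pow_left h2 10
  have hfin : Finite (TensorProduct F E ((Fin d → F) × (Fin d → F))) :=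
    Module.finite_of_finite E
  have hU := fun i => P.finrank_U i
  obtain ⟨B, hB, hBrank⟩ := exists_broadcast_subspace (fun i => doubledBaseChange E (P.U i)) hcard
    (fun i => doubledBaseChange E (P.side i)) (fun i => doubledBaseChange_mono (P.side_le_U i))
    l m w s
    (fun i => by
      have := k₁ i
      have := hU i
      zify
      rw [finrank_doubledBaseChange, finrank_doubledBaseChange]
      push_cast
      linarith)
    (fun i => by
      have hk := k₂ i
      have := hU i
      zify
      rw [← doubledBaseChange_inf, ← doubledBaseChange_inf, finrank_doubled_sup,
        finrank_doubledBaseChange]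
      push_cast
      simp only [U123] at hk
      linarith)
    (fun i => by
      have := k₃ i
      have := hU i
      zify
      rw [← doubledBaseChange_inf, finrank_doubled_sup, finrank_doubledBaseChange]
      push_cast
      simp only [bn, Uinter] at *
      linarith)
    (fun i => by
      have := k₄ i
      have := hU i
      zify
      rw [← doubledBaseChange_inf, finrank_doubled_sup, finrank_doubledBaseChange]
      push_cast
      simp only [bp, Uinter] at *
      linarith)
    (fun i => by
      have := k₅ i
      have := hU i
      zify
      rw [← doubledBaseChange_inf, ← doubledBaseChange_inf, ← doubledBaseChange_sup,
        finrank_doubled_sup, finrank_doubledBaseChange]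
      push_cast
      simp only [c, Uinter] at *
      linarith)
    (fun i => by
      have := k₆ i
      have := hU i
      zify
      rw [← doubledBaseChange_sup, ← doubledBaseChange_inf,
        finrank_doubled_sup, finrank_doubledBaseChange]
      push_cast
      simp only [e, UinterSum] at *
      linarith)
  obtain ⟨sch, hsch⟩ := P.exists_scheme_of_subspace B hB
  refine ⟨sch, ?_⟩
  have h3 : (Module.finrank E B : ℤ) ≤ 2 * ∑ i, intCondRank (P.demand i) (P.side i) - t :=
    le_trans (by exact_mod_cast hBrank) hcost
  have h4 : (Module.finrank E B : ℝ) ≤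
      2 * ((∑ i, intCondRank (P.demand i) (P.side i) : ℤ) : ℝ) - t := by exact_mod_cast h3
  rw [Fin.sum_univ_three] at h4
  rw [hsch, demandRank, condRank_eq_intCondRank, condRank_eq_intCondRank, condRank_eq_intCondRank]
  push_cast at h4
  linarith

end LCBC

/-! ### Entropy of equivalence relations. -/

section ClassEntropy

variable {Ω : Type*} [Fintype Ω]

open Classical in
/-- Number of elements equivalent to `x`. -/
noncomputable def classCard (r : Setoid Ω) (x : Ω) : ℕ := (Finset.univ.filter fun y => r x y).card

/-- Sum of the logarithms of the class sizes: up to normalization the conditional entropy of a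
uniformly distributed point given its equivalence class. -/
noncomputable def classEntropy (r : Setoid Ω) : ℝ := ∑ x, Real.log (classCard r x)

theorem classCard_pos (r : Setoid Ω) (x : Ω) : 0 < classCard r x :=
  Finset.card_pos.mpr ⟨x, by simp⟩

theorem classCard_congr (r : Setoid Ω) {x y : Ω} (h : r x y) : classCard r x = classCard r y := by
  classical
  unfold classCard
  congr 1
  ext z
  simp only [Finset.mem_filter_univ]
  exact ⟨fun hz => r.trans (r.symm h) hz, fun hz => r.trans h hz⟩

theorem classEntropy_mono {r s : Setoid Ω} (h : r ≤ s) : classEntropy r ≤ classEntropy s := by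
  classical
  refine Finset.sum_le_sum fun x _ => Real.log_le_log (by exact_mod_cast classCard_pos r x) ?_
  have : classCard r x ≤ classCard s x :=
    Finset.card_le_card (Finset.monotone_filter_right _ fun y _ hy => h hy)
  exact_mod_cast this

/-- This is nonnegativity of conditional mutual information. By `log u ≤ u - 1` it suffices that the
ratios of class sizes |r||s| / (|r ⊓ s||q|) sum to at most `|Ω|`, which is a count of triples. -/
theorem classEntropy_submodular {r s q : Setoid Ω} (hr : r ≤ q) (hs : s ≤ q) :
    classEntropy r + classEntropy s ≤ classEntropy (r ⊓ s) + classEntropy q := by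
  classical
  have hpos : ∀ (p : Setoid Ω) x, (0 : ℝ) < classCard p x := fun p x => by
    exact_mod_cast classCard_pos p x
  have hcount : ∀ (p : Setoid Ω) x, (classCard p x : ℝ) = ∑ y, if p x y then (1 : ℝ) else 0 := by
    intro p x
    rw [classCard, Finset.sum_boole]
  have hsum : ∑ x, (classCard r x * classCard s x : ℝ) / (classCard (r ⊓ s) x * classCard q x) ≤
      ∑ _x : Ω, (1 : ℝ) := by
    calc ∑ x, (classCard r x * classCard s x : ℝ) / (classCard (r ⊓ s) x * classCard q x)
        = ∑ x, ∑ a, ∑ b, if r x a ∧ s x b then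
            ((classCard (r ⊓ s) x * classCard q x : ℝ))⁻¹ else 0 := by
          refine Finset.sum_congr rfl fun x _ => ?_
          rw [hcount r, hcount s, Finset.sum_mul_sum, div_eq_mul_inv, Finset.sum_mul]
          refine Finset.sum_congr rfl fun a _ => ?_
          rw [Finset.sum_mul]
          refine Finset.sum_congr rfl fun b _ => ?_
          by_cases h1 : r x a <;> by_cases h2 : s x b <;> simp [h1, h2]
      _ = ∑ a, ∑ b, ∑ x, if r x a ∧ s x b then
            ((classCard (r ⊓ s) x * classCard q x : ℝ))⁻¹ else 0 := by
          rw [Finset.sum_comm]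
          exact Finset.sum_congr rfl fun a _ => Finset.sum_comm
      _ ≤ ∑ a, ∑ b, if q a b then (classCard q a : ℝ)⁻¹ else 0 := by
          refine Finset.sum_le_sum fun a _ => Finset.sum_le_sum fun b _ => ?_
          -- For fixed `a` and `b`, the admissible `x` form a single class of `r ⊓ s` or none, and
          -- `a`, `b` are then `q`-equivalent. The inner sum is therefore the inverse size of one
          -- `q`-class, or zero.
          by_cases hex : ∃ x, r x a ∧ s x b
          · obtain ⟨x₀, h1, h2⟩ := hex
            have hab : q a b := q.trans (q.symm (hr h1)) (hs h2)
            have hterm : ∀ x, (if r x a ∧ s x b then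
                ((classCard (r ⊓ s) x * classCard q x : ℝ))⁻¹ else 0) =
                (if (r ⊓ s) x₀ x then 1 else 0) *
                  ((classCard (r ⊓ s) x₀ * classCard q a : ℝ))⁻¹ := by
              intro x
              have hiff : (r x a ∧ s x b) ↔ (r ⊓ s) x₀ x :=
                ⟨fun h => ⟨r.trans h1 (r.symm h.1), s.trans h2 (s.symm h.2)⟩,
                  fun h => ⟨r.trans (r.symm h.1) h1, s.trans (s.symm h.2) h2⟩⟩
              by_cases h : (r ⊓ s) x₀ x
              · rw [if_pos (hiff.mpr h), if_pos h, one_mul, classCard_congr (r ⊓ s) h,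
                  classCard_congr q (hr (hiff.mpr h).1)]
              · rw [if_neg fun hn => h (hiff.mp hn), if_neg h, zero_mul]
            rw [Finset.sum_congr rfl fun x _ => hterm x, ← Finset.sum_mul, ← hcount, if_pos hab,
              mul_inv, ← mul_assoc, mul_inv_cancel₀ (hpos _ _).ne', one_mul]
          · rw [Finset.sum_eq_zero fun x _ => if_neg fun h => hex ⟨x, h⟩]
            split_ifs
            · exact (inv_pos.mpr (hpos q a)).le
            · exact le_rfl
      _ = ∑ _a : Ω, (1 : ℝ) := by
          refine Finset.sum_congr rfl fun a _ => ?_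
          rw [← mul_inv_cancel₀ (hpos q a).ne', hcount q a, Finset.sum_mul]
          refine Finset.sum_congr rfl fun b _ => ?_
          split_ifs <;> simp
  have hlog : ∑ x, (Real.log (classCard r x) + Real.log (classCard s x) -
      (Real.log (classCard (r ⊓ s) x) + Real.log (classCard q x))) ≤
      ∑ x, ((classCard r x * classCard s x : ℝ) / (classCard (r ⊓ s) x * classCard q x) - 1) := by
    refine Finset.sum_le_sum fun x _ => ?_
    have h1 := hpos r x
    have h2 := hpos s x
    have h3 := hpos (r ⊓ s) x
    have h4 := hpos q x
    rw [← Real.log_mul h1.ne' h2.ne', ← Real.log_mul h3.ne' h4.ne',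
      ← Real.log_div (mul_pos h1 h2).ne' (mul_pos h3 h4).ne']
    exact Real.log_le_sub_one_of_pos (div_pos (mul_pos h1 h2) (mul_pos h3 h4))
  rw [Finset.sum_sub_distrib] at hlog
  simp only [Finset.sum_sub_distrib, Finset.sum_add_distrib] at hlog
  simp only [classEntropy]
  linarith

/-- A description by letters of an alphabet `S` carries at most `log |S|` of information. -/
theorem le_classEntropy_ker {S : Type*} [Fintype S] (f : Ω → S) :
    Fintype.card Ω * (Real.log (Fintype.card Ω) - Real.log (Fintype.card S)) ≤
      classEntropy (Setoid.ker f) := by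
  classical
  rcases isEmpty_or_nonempty Ω with hΩ | ⟨⟨x₀⟩⟩
  · simp [classEntropy]
  have : Nonempty S := ⟨f x₀⟩
  have : Nonempty Ω := ⟨x₀⟩
  have hΩ : (0 : ℝ) < Fintype.card Ω := by exact_mod_cast Fintype.card_pos
  have hS : (0 : ℝ) < Fintype.card S := by exact_mod_cast Fintype.card_pos
  have hpos : ∀ x, (0 : ℝ) < classCard (Setoid.ker f) x := fun x => by
    exact_mod_cast classCard_pos _ x
  -- Each nonempty fibre contributes exactly one, so the sum counts the letters in use.
  have hinv : ∑ x, ((classCard (Setoid.ker f) x : ℝ))⁻¹ ≤ Fintype.card S := by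
    rw [← Finset.sum_fiberwise (s := Finset.univ) (g := f)]
    calc _ ≤ ∑ _c : S, (1 : ℝ) := by
          refine Finset.sum_le_sum fun c _ => ?_
          have hterm : ∀ x ∈ Finset.univ.filter (fun x => f x = c),
              ((classCard (Setoid.ker f) x : ℝ))⁻¹ =
                ((Finset.univ.filter fun x => f x = c).card : ℝ)⁻¹ := by
            intro x hx
            have hx' : f x = c := by simpa using hx
            unfold classCard
            congr 3
            ext y
            simp only [Finset.mem_filter_univ, Setoid.ker_def, hx']
            exact eq_comm
          rw [Finset.sum_congr rfl hterm, Finset.sum_const, nsmul_eq_mul]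
          exact mul_inv_le_one
      _ = Fintype.card S := by simp
  have hlog : ∑ x, (Real.log (Fintype.card Ω) - Real.log (Fintype.card S) -
      Real.log (classCard (Setoid.ker f) x)) ≤
      ∑ x, (Fintype.card Ω / Fintype.card S * ((classCard (Setoid.ker f) x : ℝ))⁻¹ - 1) := by
    refine Finset.sum_le_sum fun x _ => ?_
    rw [← Real.log_div hΩ.ne' hS.ne', ← Real.log_div (div_pos hΩ hS).ne' (hpos x).ne',
      ← div_eq_mul_inv]
    exact Real.log_le_sub_one_of_pos (div_pos (div_pos hΩ hS) (hpos x))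
  simp only [Finset.sum_sub_distrib, ← Finset.mul_sum, Finset.sum_const, Finset.card_univ,
    nsmul_eq_mul, mul_one] at hlog
  have h2 := mul_le_mul_of_nonneg_left hinv (div_pos hΩ hS).le
  rw [div_mul_cancel₀ _ hS.ne'] at h2
  simp only [classEntropy]
  linarith

end ClassEntropy

/-! ### Data known along a subspace. -/

namespace LCBC

variable {F : Type*} [Field F] {d L : ℕ}

variable (L) in
/-- Data matrices are equivalent if they agree on a subspace. -/
def agreeOn (T : Submodule F (Fin d → F)) : Setoid (Matrix (Fin d) (Fin L) F) where
  r X Y := ∀ v ∈ T, X.transpose.mulVec v = Y.transpose.mulVec v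
  iseqv := ⟨fun _ _ _ => rfl, fun h v hv => (h v hv).symm,
    fun h h' v hv => (h v hv).trans (h' v hv)⟩

theorem agreeOn_anti {T T' : Submodule F (Fin d → F)} (h : T ≤ T') :
    agreeOn L T' ≤ agreeOn L T := fun {_ _} hXY v hv => hXY v (h hv)

theorem agreeOn_sup (T T' : Submodule F (Fin d → F)) :
    agreeOn L (T ⊔ T') = agreeOn L T ⊓ agreeOn L T' := by
  refine le_antisymm (le_inf (agreeOn_anti le_sup_left) (agreeOn_anti le_sup_right)) ?_
  rintro X Y ⟨h, h'⟩ v hv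
  obtain ⟨y, hy, z, hz, rfl⟩ := Submodule.mem_sup.mp hv
  rw [Matrix.mulVec_add, Matrix.mulVec_add, h y hy, h' z hz]

variable [Fintype F]

-- The class of `X` is a translate of the kernel of the restriction map to `T →ₗ[F] (Fin L → F)`,
-- which is onto because linear maps extend from subspaces.
open Classical in
theorem classCard_agreeOn (T : Submodule F (Fin d → F)) (X : Matrix (Fin d) (Fin L) F) :
    classCard (agreeOn L T) X = Fintype.card F ^ (L * (d - Module.finrank F T)) := by
  let restrict : Matrix (Fin d) (Fin L) F →ₗ[F] (T →ₗ[F] (Fin L → F)) :=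
    { toFun := fun Y => Y.transpose.mulVecLin.domRestrict T
      map_add' := fun Y Z => by
        ext v i
        simp [Matrix.transpose_add]
      map_smul' := fun c Y => by
        ext v i
        simp [Matrix.transpose_smul] }
  have hsurj : LinearMap.range restrict = ⊤ := by
    rw [LinearMap.range_eq_top]
    intro g
    obtain ⟨g', hg'⟩ := g.exists_extend
    refine ⟨(LinearMap.toMatrix' g').transpose, ?_⟩
    ext v i
    have : (LinearMap.toMatrix' g').mulVec v = g' v := LinearMap.toMatrix'_mulVec g' v
    simp only [restrict, LinearMap.coe_mk, AddHom.coe_mk, LinearMap.domRestrict_apply,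
      Matrix.transpose_transpose, Matrix.mulVecLin_apply, this, ← hg']
    rfl
  have hrank := LinearMap.finrank_range_add_finrank_ker restrict
  rw [hsurj, finrank_top, Module.finrank_linearMap F F, Module.finrank_matrix, Module.finrank_pi,
    Fintype.card_fin, Fintype.card_fin, Module.finrank_self, mul_one] at hrank
  have hker : Module.finrank F (LinearMap.ker restrict) = L * (d - Module.finrank F T) := by
    rw [Nat.mul_sub, mul_comm L d, mul_comm L]
    omega
  rw [← hker, ← Nat.card_eq_fintype_card, ← Module.natCard_eq_pow_finrank,
    Nat.card_eq_fintype_card, Fintype.card_subtype, classCard]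
  refine Finset.card_bij (fun Y _ => Y - X) (fun Y hY => ?_) (fun Y _ Z _ h => by simpa using h)
    (fun Z hZ => ⟨Z + X, ?_, by simp⟩)
  · simp only [Finset.mem_filter_univ, LinearMap.mem_ker] at hY ⊢
    rw [map_sub, sub_eq_zero]
    ext v i
    exact (congrFun (hY v v.2) i).symm
  · simp only [Finset.mem_filter_univ, LinearMap.mem_ker] at hZ ⊢
    intro v hv
    have := LinearMap.congr_fun hZ ⟨v, hv⟩
    have h0 : Z.transpose.mulVec v = 0 := this
    rw [Matrix.transpose_add, Matrix.add_mulVec, h0, zero_add]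

theorem classEntropy_agreeOn (T : Submodule F (Fin d → F)) :
    classEntropy (agreeOn L T) = Fintype.card (Matrix (Fin d) (Fin L) F) *
      (L * (d - Module.finrank F T) * Real.log (Fintype.card F)) := by
  have hle : Module.finrank F T ≤ d := by
    simpa using Submodule.finrank_le T
  simp only [classEntropy, classCard_agreeOn, Nat.cast_pow, Real.log_pow, Finset.sum_const,
    Finset.card_univ, nsmul_eq_mul]
  push_cast [Nat.cast_sub hle]
  ring

end LCBC

/-! ### The converse bounds. -/

namespace LCBC

section Converse

variable {F : Type*} [Field F] {d : ℕ} (P : LCBC F 3 d)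

theorem demandRank_eq {i j k : Fin 3} (hij : i ≠ j) (hik : i ≠ k) (hjk : j ≠ k) :
    P.demandRank = condRank (P.demand i) (P.side i) + condRank (P.demand j) (P.side j) +
      condRank (P.demand k) (P.side k) := by
  have key : ∀ f : Fin 3 → ℝ, f 0 + f 1 + f 2 = f i + f j + f k := by
    intro f
    fin_cases i <;> fin_cases j <;> fin_cases k <;> simp at hij hik hjk ⊢ <;> ring
  exact key fun l => condRank (P.demand l) (P.side l)

theorem U123_eq {i j k : Fin 3} (hij : i ≠ j) (hik : i ≠ k) (hjk : j ≠ k) :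
    P.U123 = P.Uinter i j ⊓ P.Uinter i k := by
  refine le_antisymm (le_inf (le_inf (P.U123_le _) (P.U123_le _))
    (le_inf (P.U123_le _) (P.U123_le _))) ?_
  have key : ∀ l, P.Uinter i j ⊓ P.Uinter i k ≤ P.U l := by
    intro l
    have : l = i ∨ l = j ∨ l = k := by omega
    rcases this with rfl | rfl | rfl
    · exact inf_le_left.trans inf_le_left
    · exact inf_le_left.trans inf_le_right
    · exact inf_le_right.trans inf_le_right
  exact le_inf (le_inf (key 0) (key 1)) (key 2)

/-- The increment of the rank from `T + V'_j` to `T + U_j`. -/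
theorem finrank_sup_U_sub (T : Submodule F (Fin d → F)) (j : Fin 3) :
    (Module.finrank F ↥(T ⊔ P.U j) : ℝ) - Module.finrank F ↥(T ⊔ P.side j) =
      condRank (P.demand j) (P.side j) - condRank (T ⊓ P.U j) (P.side j) := by
  have h1 := Submodule.finrank_sup_add_finrank_inf_eq T (P.U j)
  have h2 := Submodule.finrank_sup_add_finrank_inf_eq T (P.side j)
  have h3 := Submodule.finrank_sup_add_finrank_inf_eq (T ⊓ P.U j) (P.side j)
  rw [inf_assoc, inf_eq_right.mpr (P.side_le_U j)] at h3
  rw [condRank, condRank, sup_comm (P.demand j), ← U_eq]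
  rify at h1 h2 h3
  linarith

/-- Giving away the side-information of user `j` only lowers `g`. Its demand then comes for free
from the broadcast, so `g` falls by exactly the rank increment from `T ⊔ P.side j` to `T ⊔ P.U j`.
-/
theorem broadcast_gain {g : Submodule F (Fin d → F) → ℝ}
    (hanti : ∀ T T', T ≤ T' → g T' ≤ g T)
    (hdec : ∀ T k, g (T ⊔ P.side k) + Module.finrank F ↥(T ⊔ P.side k) =
      g (T ⊔ P.U k) + Module.finrank F ↥(T ⊔ P.U k)) (T : Submodule F (Fin d → F)) (j : Fin 3) :
    g (T ⊔ P.U j) + condRank (P.demand j) (P.side j) - condRank (T ⊓ P.U j) (P.side j) ≤ g T := by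
  have h1 := P.finrank_sup_U_sub T j
  have h2 := hdec T j
  have h3 := hanti T (T ⊔ P.side j) le_sup_left
  linarith

theorem broadcast_gain_of_le {g : Submodule F (Fin d → F) → ℝ}
    (hanti : ∀ T T', T ≤ T' → g T' ≤ g T)
    (hdec : ∀ T k, g (T ⊔ P.side k) + Module.finrank F ↥(T ⊔ P.side k) =
      g (T ⊔ P.U k) + Module.finrank F ↥(T ⊔ P.U k)) {T : Submodule F (Fin d → F)} {j : Fin 3}
    (hT : T ≤ P.U j) :
    g (P.U j) + condRank (P.demand j) (P.side j) - condRank T (P.side j) ≤ g T := by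
  have := P.broadcast_gain hanti hdec T j
  rwa [sup_eq_right.mpr hT, inf_eq_left.mpr hT] at this

theorem broadcast_gain_bot {g : Submodule F (Fin d → F) → ℝ}
    (hanti : ∀ T T', T ≤ T' → g T' ≤ g T)
    (hdec : ∀ T k, g (T ⊔ P.side k) + Module.finrank F ↥(T ⊔ P.side k) =
      g (T ⊔ P.U k) + Module.finrank F ↥(T ⊔ P.U k)) (j : Fin 3) :
    g (P.U j) + condRank (P.demand j) (P.side j) ≤ g ⊥ := by
  have := P.broadcast_gain_of_le hanti hdec (T := ⊥) (j := j) bot_le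
  have h0 : condRank ⊥ (P.side j) = 0 := by rw [condRank, bot_sup_eq, sub_self]
  linarith

/-- The gains are added as the signal spaces of `i`, `j`, `k` are adjoined in this order; no
submodularity is needed. -/
theorem delta1_le_of_submodular {g : Submodule F (Fin d → F) → ℝ}
    (hanti : ∀ T T', T ≤ T' → g T' ≤ g T) (hnonneg : ∀ T, 0 ≤ g T)
    (hdec : ∀ T k, g (T ⊔ P.side k) + Module.finrank F ↥(T ⊔ P.side k) =
      g (T ⊔ P.U k) + Module.finrank F ↥(T ⊔ P.U k))
    {i j k : Fin 3} (hij : i ≠ j) (hik : i ≠ k) (hjk : j ≠ k) : P.delta1 i j k ≤ g ⊥ := by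
  have h1 := P.broadcast_gain_bot hanti hdec i
  have h2 := P.broadcast_gain hanti hdec (P.U i) j
  have h3 := P.broadcast_gain hanti hdec (P.U i ⊔ P.U j) k
  have h4 := hnonneg (P.U i ⊔ P.U j ⊔ P.U k)
  rw [inf_comm (P.U i ⊔ P.U j)] at h3
  rw [delta1, P.demandRank_eq hij hik hjk, Uinter, UinterSum]
  linarith

/-- Submodularity for `U_i, U_j`, for `U_i, U_k` and for `U_ij, U_ik` combines to g(U_i + U_j) +
g(U_i + U_k) + g(U_ij + U_ik) + g(U_123) ≤ 2 g(U_i) + g(U_j) + g(U_k). The terms on the left are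
bounded below by gains, the last one through the minimizing user `l`. -/
theorem delta2_le_of_submodular {g : Submodule F (Fin d → F) → ℝ}
    (hanti : ∀ T T', T ≤ T' → g T' ≤ g T) (hnonneg : ∀ T, 0 ≤ g T)
    (hsub : ∀ T T', g (T ⊔ T') + g (T ⊓ T') ≤ g T + g T')
    (hdec : ∀ T k, g (T ⊔ P.side k) + Module.finrank F ↥(T ⊔ P.side k) =
      g (T ⊔ P.U k) + Module.finrank F ↥(T ⊔ P.U k))
    {i j k : Fin 3} (hij : i ≠ j) (hik : i ≠ k) (hjk : j ≠ k) : P.delta2 i j k ≤ g ⊥ := by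
  obtain ⟨l, -, hl⟩ := Finset.exists_mem_eq_inf' (Finset.univ_nonempty (α := Fin 3))
    (fun l : Fin 3 => condRank P.U123 (P.side l))
  rw [delta2, hl, P.demandRank_eq hij hik hjk]
  have hi := P.broadcast_gain_bot hanti hdec i
  have hj := P.broadcast_gain_bot hanti hdec j
  have hk := P.broadcast_gain_bot hanti hdec k
  have h1 := hsub (P.U i) (P.U j)
  have h2 := hsub (P.U i) (P.U k)
  have h3 := hsub (P.Uinter i j) (P.Uinter i k)
  rw [← P.U123_eq hij hik hjk] at h3
  have h4 := P.broadcast_gain_of_le hanti hdec (T := P.Uinter i j ⊔ P.Uinter i k) (j := i)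
    (sup_le inf_le_left inf_le_left)
  have h5 := P.broadcast_gain_of_le hanti hdec (P.U123_le l)
  have h6 := P.broadcast_gain hanti hdec (P.U i ⊔ P.U j) k
  have h7 := P.broadcast_gain hanti hdec (P.U i ⊔ P.U k) j
  have h8 := hnonneg (P.U i ⊔ P.U j ⊔ P.U k)
  have h9 := hnonneg (P.U i ⊔ P.U k ⊔ P.U j)
  rw [inf_comm (P.U i ⊔ P.U j)] at h6
  rw [inf_comm (P.U i ⊔ P.U k)] at h7
  simp only [Uinter, UinterSum] at *
  -- After cancellation, `g (P.U _)` survives on the right for the two users other than `l` only.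
  -- Each is bounded by `g ⊥` minus that user's demand rank, which yields `2 * g ⊥`.
  have : l = i ∨ l = j ∨ l = k := by omega
  rcases this with rfl | rfl | rfl <;> linarith

variable {P} [Fintype F]

/-- Data matrices are equivalent if they agree on a subspace and have the same encoding. -/
def Scheme.agreeOn (s : P.Scheme) (T : Submodule F (Fin d → F)) :
    Setoid (Matrix (Fin d) (Fin s.L) F) :=
  LCBC.agreeOn s.L T ⊓ Setoid.ker s.enc

open Classical in
/-- The normalized conditional entropy of the broadcast symbol given the uniformly distributed
data on a subspace. -/
noncomputable def Scheme.remainder (s : P.Scheme) (T : Submodule F (Fin d → F)) : ℝ :=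
  d - Module.finrank F T - classEntropy (s.agreeOn T) /
    (Fintype.card (Matrix (Fin d) (Fin s.L) F) * (s.L * Real.log (Fintype.card F)))

theorem Scheme.normalization_pos (s : P.Scheme) [Fintype (Matrix (Fin d) (Fin s.L) F)] :
    (0 : ℝ) < Fintype.card (Matrix (Fin d) (Fin s.L) F) *
      (s.L * Real.log (Fintype.card F)) := by
  have h1 : (1 : ℝ) < Fintype.card F := by exact_mod_cast Fintype.one_lt_card
  have h2 : (0 : ℝ) < s.L := by exact_mod_cast s.L_pos
  have h3 : (0 : ℝ) < Fintype.card (Matrix (Fin d) (Fin s.L) F) := by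
    exact_mod_cast Fintype.card_pos
  exact mul_pos h3 (mul_pos h2 (Real.log_pos h1))

/-- Conditioning reduces entropy: submodularity is applied to knowing the data on `T'` and to
knowing the data on `T` together with the symbol. -/
theorem Scheme.remainder_anti (s : P.Scheme) (T T' : Submodule F (Fin d → F)) (h : T ≤ T') :
    s.remainder T' ≤ s.remainder T := by
  classical
  have hsub := classEntropy_submodular (r := LCBC.agreeOn s.L T') (s := s.agreeOn T)
    (q := LCBC.agreeOn s.L T) (agreeOn_anti h) inf_le_left
  have heq : LCBC.agreeOn s.L T' ⊓ s.agreeOn T = s.agreeOn T' := by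
    rw [Scheme.agreeOn, Scheme.agreeOn, ← inf_assoc, inf_eq_left.mpr (agreeOn_anti h)]
  rw [heq, classEntropy_agreeOn, classEntropy_agreeOn] at hsub
  have hpos := s.normalization_pos
  have : classEntropy (s.agreeOn T) / (Fintype.card (Matrix (Fin d) (Fin s.L) F) *
      (s.L * Real.log (Fintype.card F))) - classEntropy (s.agreeOn T') /
      (Fintype.card (Matrix (Fin d) (Fin s.L) F) * (s.L * Real.log (Fintype.card F))) ≤
      Module.finrank F T' - Module.finrank F T := by
    rw [← sub_div, div_le_iff₀ hpos]
    linarith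
  simp only [Scheme.remainder]
  linarith

theorem Scheme.remainder_submodular (s : P.Scheme) (T T' : Submodule F (Fin d → F)) :
    s.remainder (T ⊔ T') + s.remainder (T ⊓ T') ≤ s.remainder T + s.remainder T' := by
  classical
  have hsub := classEntropy_submodular (r := s.agreeOn T) (s := s.agreeOn T')
    (q := s.agreeOn (T ⊓ T')) (inf_le_inf_right _ (agreeOn_anti inf_le_left))
    (inf_le_inf_right _ (agreeOn_anti inf_le_right))
  have heq : s.agreeOn T ⊓ s.agreeOn T' = s.agreeOn (T ⊔ T') := by
    rw [Scheme.agreeOn, Scheme.agreeOn, Scheme.agreeOn, agreeOn_sup, inf_inf_inf_comm, inf_idem]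
  rw [heq] at hsub
  have hdiv := div_le_div_of_nonneg_right hsub s.normalization_pos.le
  rw [add_div, add_div] at hdiv
  have hrank := Submodule.finrank_sup_add_finrank_inf_eq T T'
  rify at hrank
  simp only [Scheme.remainder]
  linarith

/-- By decodability, data with equal encodings that agree on the side-information agree on the
demand, so the two equivalence relations coincide. -/
theorem Scheme.remainder_side (s : P.Scheme) (T : Submodule F (Fin d → F)) (k : Fin 3) :
    s.remainder (T ⊔ P.side k) + Module.finrank F ↥(T ⊔ P.side k) =
      s.remainder (T ⊔ P.U k) + Module.finrank F ↥(T ⊔ P.U k) := by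
  have heq : s.agreeOn (T ⊔ P.side k) = s.agreeOn (T ⊔ P.U k) := by
    refine le_antisymm ?_ (inf_le_inf_right _ (agreeOn_anti (sup_le_sup_left (P.side_le_U k) _)))
    rintro X Y ⟨hXY, henc⟩
    rw [agreeOn_sup] at hXY
    obtain ⟨hT, hside⟩ := hXY
    refine ⟨?_, henc⟩
    have hdemand : ∀ v ∈ P.demand k, X.transpose.mulVec v = Y.transpose.mulVec v := by
      rw [demand, ← transpose_mul_eq_iff, ← s.decodes, ← s.decodes,
        (transpose_mul_eq_iff X Y (P.V' k)).mpr hside, show s.enc X = s.enc Y from henc]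
    rw [U_eq, agreeOn_sup, agreeOn_sup]
    exact ⟨hT, hside, hdemand⟩
  simp only [Scheme.remainder, heq]
  ring

theorem Scheme.remainder_nonneg (s : P.Scheme) (T : Submodule F (Fin d → F)) :
    0 ≤ s.remainder T := by
  classical
  refine le_trans ?_ (s.remainder_anti T ⊤ le_top)
  have h1 : classEntropy (s.agreeOn ⊤) ≤ classEntropy (LCBC.agreeOn s.L ⊤) :=
    classEntropy_mono inf_le_left
  rw [classEntropy_agreeOn, finrank_top, Module.finrank_fin_fun, sub_self, mul_zero, zero_mul,
    mul_zero] at h1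
  have h2 := div_nonpos_of_nonpos_of_nonneg h1 s.normalization_pos.le
  rw [Scheme.remainder, finrank_top, Module.finrank_fin_fun]
  linarith

/-- With nothing known, the relation is the kernel of the encoder, and the entropy of the symbol is
at most the logarithm of the alphabet size. -/
theorem Scheme.remainder_bot_le_cost (s : P.Scheme) : s.remainder ⊥ ≤ s.cost := by
  classical
  have h1 := le_classEntropy_ker s.enc
  have heq : s.agreeOn ⊥ = Setoid.ker s.enc := by
    refine inf_eq_right.mpr fun {X Y} _ v hv => ?_
    rw [(Submodule.mem_bot F).mp hv, Matrix.mulVec_zero, Matrix.mulVec_zero]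
  have hcard : Real.log (Fintype.card (Matrix (Fin d) (Fin s.L) F)) =
      d * (s.L * Real.log (Fintype.card F)) := by
    rw [← Nat.card_eq_fintype_card, Module.natCard_eq_pow_finrank (K := F),
      Module.finrank_matrix, Module.finrank_self, Fintype.card_fin, Fintype.card_fin,
      Nat.card_eq_fintype_card, Nat.cast_pow, Real.log_pow]
    push_cast
    ring
  have hpos := s.normalization_pos
  have hlog : (0 : ℝ) < s.L * Real.log (Fintype.card F) :=
    (pos_iff_pos_of_mul_pos hpos).mp (by exact_mod_cast Fintype.card_pos)
  have hL : (0 : ℝ) < s.L := by exact_mod_cast s.L_pos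
  have h2 : d - s.cost ≤ classEntropy (s.agreeOn ⊥) /
      (Fintype.card (Matrix (Fin d) (Fin s.L) F) * (s.L * Real.log (Fintype.card F))) := by
    rw [heq, le_div_iff₀ hpos]
    refine le_trans (le_of_eq ?_) h1
    have hlog' : Real.log (Fintype.card F) ≠ 0 := fun h => by simp [h] at hlog
    rw [hcard, Scheme.cost, Real.logb]
    field_simp
  rw [Scheme.remainder, finrank_bot, heq]
  rw [heq] at h2
  push_cast
  linarith

theorem Scheme.delta1_le_cost (s : P.Scheme) {i j k : Fin 3} (hij : i ≠ j) (hik : i ≠ k)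
    (hjk : j ≠ k) : P.delta1 i j k ≤ s.cost :=
  (P.delta1_le_of_submodular s.remainder_anti s.remainder_nonneg s.remainder_side
    hij hik hjk).trans s.remainder_bot_le_cost

theorem Scheme.delta2_le_cost (s : P.Scheme) {i j k : Fin 3} (hij : i ≠ j) (hik : i ≠ k)
    (hjk : j ≠ k) : P.delta2 i j k ≤ s.cost :=
  (P.delta2_le_of_submodular s.remainder_anti s.remainder_nonneg s.remainder_submodular
    s.remainder_side hij hik hjk).trans s.remainder_bot_le_cost

end Converse

/-! ### The two bounds meet. -/

section Capacity

variable {F : Type*} [Field F] {d : ℕ} (P : LCBC F 3 d)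

theorem perm_ne (σ : Equiv.Perm (Fin 3)) : σ 0 ≠ σ 1 ∧ σ 0 ≠ σ 2 ∧ σ 1 ≠ σ 2 := by
  simp

theorem exists_perm_eq : ∀ i j k : Fin 3, i ≠ j → i ≠ k → j ≠ k →
    ∃ σ : Equiv.Perm (Fin 3), σ 0 = i ∧ σ 1 = j ∧ σ 2 = k := by
  decide

theorem delta1_le_Delta1 {i j k : Fin 3} (hij : i ≠ j) (hik : i ≠ k) (hjk : j ≠ k) :
    P.delta1 i j k ≤ P.Delta1 := by
  obtain ⟨σ, rfl, rfl, rfl⟩ := exists_perm_eq i j k hij hik hjk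
  exact Finset.le_sup' (fun σ : Equiv.Perm (Fin 3) => P.delta1 (σ 0) (σ 1) (σ 2))
    (Finset.mem_univ σ)

theorem delta2_le_Delta2 {i j k : Fin 3} (hij : i ≠ j) (hik : i ≠ k) (hjk : j ≠ k) :
    P.delta2 i j k ≤ P.Delta2 := by
  obtain ⟨σ, rfl, rfl, rfl⟩ := exists_perm_eq i j k hij hik hjk
  exact Finset.le_sup' (fun σ : Equiv.Perm (Fin 3) => P.delta2 (σ 0) (σ 1) (σ 2))
    (Finset.mem_univ σ)

theorem exists_max_eq : ∃ i j k : Fin 3, i ≠ j ∧ i ≠ k ∧ j ≠ k ∧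
    (max P.Delta1 P.Delta2 = P.delta1 i j k ∨ max P.Delta1 P.Delta2 = P.delta2 i j k) := by
  rcases max_choice P.Delta1 P.Delta2 with h | h
  · obtain ⟨σ, -, hσ⟩ := Finset.exists_mem_eq_sup' Finset.univ_nonempty
      (fun σ : Equiv.Perm (Fin 3) => P.delta1 (σ 0) (σ 1) (σ 2))
    exact ⟨σ 0, σ 1, σ 2, (perm_ne σ).1, (perm_ne σ).2.1, (perm_ne σ).2.2, Or.inl (h.trans hσ)⟩
  · obtain ⟨σ, -, hσ⟩ := Finset.exists_mem_eq_sup' Finset.univ_nonempty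
      (fun σ : Equiv.Perm (Fin 3) => P.delta2 (σ 0) (σ 1) (σ 2))
    exact ⟨σ 0, σ 1, σ 2, (perm_ne σ).1, (perm_ne σ).2.1, (perm_ne σ).2.2, Or.inr (h.trans hσ)⟩

theorem exists_scheme_cost_le_max [Fintype F] :
    ∃ s : P.Scheme, s.cost ≤ max P.Delta1 P.Delta2 := by
  obtain ⟨l, -, hl⟩ := Finset.exists_mem_eq_inf' (Finset.univ_nonempty (α := Fin 3))
    (fun l : Fin 3 => condRank P.U123 (P.side l))
  set a := intCondRank P.U123 (P.side l) with ha
  have hinf : Finset.univ.inf' Finset.univ_nonempty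
      (fun l : Fin 3 => condRank P.U123 (P.side l)) = a := by
    rw [hl, condRank_eq_intCondRank]
  have hag : ∀ i, a ≤ intCondRank P.U123 (P.side i) := by
    intro i
    have := Finset.inf'_le (fun l : Fin 3 => condRank P.U123 (P.side l)) (Finset.mem_univ i)
    rw [hinf, condRank_eq_intCondRank] at this
    exact_mod_cast this
  have hd1 : ∀ i j k, P.delta1 i j k = P.demandRank - ((2 * (intCondRank (P.Uinter i j)
      (P.side j) + intCondRank (P.UinterSum k i j) (P.side k)) : ℤ) : ℝ) / 2 := by
    intro i j k
    rw [delta1, condRank_eq_intCondRank, condRank_eq_intCondRank]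
    push_cast
    ring
  have hd2 : ∀ i j k, P.delta2 i j k = P.demandRank - ((a + intCondRank
      (P.Uinter i j ⊔ P.Uinter i k) (P.side i) + intCondRank (P.UinterSum j i k) (P.side j) +
      intCondRank (P.UinterSum k i j) (P.side k) : ℤ) : ℝ) / 2 := by
    intro i j k
    rw [delta2, hinf, condRank_eq_intCondRank, condRank_eq_intCondRank, condRank_eq_intCondRank]
    push_cast
    ring
  have hmono : ∀ (i : Fin 3) (A : Submodule F (Fin d → F)), P.U123 ≤ A →
      a ≤ intCondRank A (P.side i) := fun i A hA => (hag i).trans (intCondRank_mono _ hA)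
  have hinter : ∀ i j, P.U123 ≤ P.Uinter i j := fun i j => le_inf (P.U123_le i) (P.U123_le j)
  have hintersum : ∀ i j k, P.U123 ≤ P.UinterSum i j k := fun i j k =>
    le_inf (P.U123_le i) ((P.U123_le j).trans le_sup_left)
  -- `t` is twice the smallest saving among all permutations. It is at least `4 * a` because `U123`
  -- lies in every space whose rank enters, and each such rank is thus at least `a`.
  obtain ⟨t, ht, hat⟩ : ∃ t : ℤ, max P.Delta1 P.Delta2 = P.demandRank - t / 2 ∧ 4 * a ≤ t := by
    obtain ⟨i, j, k, -, -, -, h | h⟩ := P.exists_max_eq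
    · refine ⟨_, h.trans (hd1 i j k), ?_⟩
      have h1 := hmono j _ (hinter i j)
      have h2 := hmono k _ (hintersum k i j)
      omega
    · refine ⟨_, h.trans (hd2 i j k), ?_⟩
      have h1 := hmono i _ ((hinter i j).trans (le_sup_left (b := P.Uinter i k)))
      have h2 := hmono j _ (hintersum j i k)
      have h3 := hmono k _ (hintersum k i j)
      omega
  rw [ht]
  refine P.exists_scheme_cost_le a t (intCondRank_nonneg _ _) hat hag
    (fun i j k hij hik hjk => ?_) (fun i j k hij hik hjk => ?_)
  · have h := (P.delta1_le_Delta1 hij hik hjk).trans (le_max_left _ P.Delta2)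
    rw [ht, hd1] at h
    rw [← Int.cast_le (R := ℝ)]
    linarith only [h]
  · have h := (P.delta2_le_Delta2 hij hik hjk).trans (le_max_right P.Delta1 _)
    rw [ht, hd2] at h
    rw [← Int.cast_le (R := ℝ)]
    linarith only [h]

theorem max_le_cost [Fintype F] (s : P.Scheme) : max P.Delta1 P.Delta2 ≤ s.cost := by
  obtain ⟨i, j, k, hij, hik, hjk, h | h⟩ := P.exists_max_eq
  · exact h.trans_le (s.delta1_le_cost hij hik hjk)
  · exact h.trans_le (s.delta2_le_cost hij hik hjk)

end Capacity

end LCBC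

theorem theorem1 {F : Type*} [Field F] [Fintype F] (d : ℕ) (P : LCBC F 3 d) :
    IsGLB P.achievableCosts (max P.Delta1 P.Delta2) ∧
      P.optimalCost = max P.Delta1 P.Delta2 ∧
      P.capacity = 1 / ENNReal.ofReal (max P.Delta1 P.Delta2) := by
  have hglb : IsGLB P.achievableCosts (max P.Delta1 P.Delta2) := by
    refine ⟨?_, fun x hx => ?_⟩
    · rintro _ ⟨s, rfl⟩
      exact P.max_le_cost s
    · obtain ⟨s, hs⟩ := P.exists_scheme_cost_le_max
      exact (hx ⟨s, rfl⟩).trans hs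
  have hopt : P.optimalCost = max P.Delta1 P.Delta2 :=
    hglb.csInf_eq (let ⟨s, _⟩ := P.exists_scheme_cost_le_max; ⟨_, s, rfl⟩)
  exact ⟨hglb, hopt, by rw [LCBC.capacity, hopt]⟩
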